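/- For $n\in\mathbb N$ let $U=U_n$ be the group of unitary $n\times n$ complex matrices. For $2\le p<\infty$ and a matrix $x$ let $\|x\|_p=\operatorname{Tr}((x^*x)^{p/2})^{1/p}$, and let $\|x\|_\infty$ be the operator norm of $x$. For a piecewise smooth curve $\gamma:[0,1]\to U$ put $L_p(\gamma)=\int_0^1\|\dot\gamma(t)\|_p\,dt$, and let $d_p(u,v)$ be the infimum of $L_p(\gamma)$ over the piecewise smooth curves $\gamma$ in $U$ that join $u$ and $v$; define $d_\infty$ likewise with $\|\cdot\|_\infty$. For $u,v\in U$ with $d_\infty(u,v)<\pi$ let $\gamma_{u,v}(t)=u\exp(t\log(u^{-1}v))$, $t\in[0,1]$, where $\log(u^{-1}v)$ is the skew-adjoint matrix $x$ with $\|x\|_\infty<\pi$ and $e^x=u^{-1}v$. A set $M\subseteq U$ is a *geodesic subset* if any two points of $M$ are joined by a piecewise smooth path in $M$ and if $\gamma_{u,v}\subseteq M$ for all $u,v\in M$ with $d_\infty(u,v)<\pi$. For a distance $d$ on $M$ and $A\subseteq M$, the *circumradius* of $A$ in $(M,d)$ is $\inf\{r:\ \exists c\in M,\ d(c,a)\le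 r \text{ for all } a\in A\}$, and a *circumcenter* of $A$ in $(M,d)$ is the center $c\in M$ of a closed ball that contains $A$ and has minimal radius among the closed balls with center in $M$ that contain $A$. **Theorem 4.7.** Let $p\ge 2$ be an even integer, $M$ a closed geodesic subset of $U_n$, and $A\subseteq M$ a finite nonempty set. If the circumradius of $A$ in $(M,d_p)$ is less than $\pi/2$, then $A$ has a unique circumcenter in $(M,d_p)$. The same holds if $d_p$ is replaced, both in the hypothesis and in the conclusion, by the interior distance of $M$, that is, by the infimum of $L_p(\gamma)$ over the piecewise smooth curves $\gamma$ in $M$ that join the two points. The bound $\pi/2$ is optimal: for every even integer $p\ge2$, the group $U_1$ is a geodesic subset of itself, the set $A=\{1,-1\}$ has circumradius exactly $\pi/2$ in $(U_1,d_p)$, and its circumcenters are exactly $i$ and $-i$, so that the circumcenter is not unique. -/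

import Mathlib

namespace FinslerUnitary

open Set
open scoped Matrix ContDiff

/-- The group `U_n` of unitary `n × n` complex matrices. -/
abbrev U (n : ℕ) := Matrix.unitaryGroup (Fin n) ℂ

/-- The `p`-Schatten norm `Tr ((x^* x)^(p/2))^(1/p)` of a matrix, for an even natural number `p`
(so that `p / 2` is an exact division and `(x^* x)^(p/2)` is an ordinary power). -/
noncomputable def schattenNorm (p : ℕ) {n : ℕ} (x : Matrix (Fin n) (Fin n) ℂ) : ℝ :=
  ((xᴴ * x) ^ (p / 2)).trace.re ^ (1 / (p : ℝ))

/-- The operator norm of a matrix acting on the Euclidean space `ℂ^n`. -/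
noncomputable def opNorm {n : ℕ} (x : Matrix (Fin n) (Fin n) ℂ) : ℝ :=
  ‖Matrix.toEuclideanCLM (n := Fin n) (𝕜 := ℂ) x‖

/-- `γ`, restricted to `[0, 1]`, is a piecewise smooth curve: there is a subdivision
`0 = τ 0 ≤ τ 1 ≤ ⋯ ≤ τ N = 1` such that all matrix entries of `γ` are `C^∞` on each closed
interval `[τ k, τ (k + 1)]`. (Continuity on `[0, 1]` follows.) -/
def IsPiecewiseSmooth {n : ℕ} (γ : ℝ → U n) : Prop :=
  ∃ (N : ℕ) (τ : ℕ → ℝ), Monotone τ ∧ τ 0 = 0 ∧ τ N = 1 ∧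
    ∀ k < N, ∀ i j : Fin n,
      ContDiffOn ℝ ∞ (fun t => (γ t : Matrix (Fin n) (Fin n) ℂ) i j) (Icc (τ k) (τ (k + 1)))

/-- The velocity of a curve of unitary matrices, computed entrywise. -/
noncomputable def velocity {n : ℕ} (γ : ℝ → U n) (t : ℝ) : Matrix (Fin n) (Fin n) ℂ :=
  Matrix.of fun i j => deriv (fun s => (γ s : Matrix (Fin n) (Fin n) ℂ) i j) t

/-- The length of the curve `γ : [0, 1] → U_n`, measured with the norm `N`. -/
noncomputable def curveLength {n : ℕ} (N : Matrix (Fin n) (Fin n) ℂ → ℝ) (γ : ℝ → U n) : ℝ :=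
  ∫ t in (0 : ℝ)..1, N (velocity γ t)

/-- `γ : [0, 1] → M` is a piecewise smooth curve inside `M` that joins `u` and `v`. -/
def Joins {n : ℕ} (M : Set (U n)) (u v : U n) (γ : ℝ → U n) : Prop :=
  IsPiecewiseSmooth γ ∧ (∀ t ∈ Icc (0 : ℝ) 1, γ t ∈ M) ∧ γ 0 = u ∧ γ 1 = v

/-- The interior (rectifiable) distance of `M ⊆ U_n` for the norm `N`: the infimum of the
lengths of the piecewise smooth curves in `M` that join the two points. -/
noncomputable def interiorDist {n : ℕ} (N : Matrix (Fin n) (Fin n) ℂ → ℝ) (M : Set (U n))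
    (u v : U n) : ℝ :=
  sInf {l : ℝ | ∃ γ : ℝ → U n, Joins M u v γ ∧ l = curveLength N γ}

/-- The Finsler distance `d_p` of `U_n`, for an even natural number `p`. -/
noncomputable def distP (p : ℕ) {n : ℕ} (u v : U n) : ℝ :=
  interiorDist (schattenNorm p) univ u v

/-- The Finsler distance `d_∞` of `U_n`. -/
noncomputable def distInf {n : ℕ} (u v : U n) : ℝ :=
  interiorDist opNorm univ u v

/-- `x` is the principal logarithm of `w`: the skew-adjoint matrix with operator norm less
than `π` and exponential `w`. -/
def IsPrincipalLog {n : ℕ} (x w : Matrix (Fin n) (Fin n) ℂ) : Prop :=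
  xᴴ = -x ∧ opNorm x < Real.pi ∧ NormedSpace.exp x = w

/-- Geodesic subsets of `U_n`: any two points of `M` are joined by a piecewise smooth path
in `M`, and for `u, v ∈ M` with `d_∞(u, v) < π` the unique geodesic
`γ_{u,v}(t) = u exp (t log (u⁻¹ v))`, `t ∈ [0, 1]`, that joins them in `U_n` is contained in `M`. -/
def IsGeodesicSubset {n : ℕ} (M : Set (U n)) : Prop :=
  (∀ u ∈ M, ∀ v ∈ M, ∃ γ : ℝ → U n, Joins M u v γ) ∧
  ∀ u ∈ M, ∀ v ∈ M, distInf u v < Real.pi →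
    ∀ x : Matrix (Fin n) (Fin n) ℂ,
      IsPrincipalLog x ((u⁻¹ * v : U n) : Matrix (Fin n) (Fin n) ℂ) →
      ∀ t ∈ Icc (0 : ℝ) 1, ∃ w ∈ M,
        (w : Matrix (Fin n) (Fin n) ℂ) =
          (u : Matrix (Fin n) (Fin n) ℂ) * NormedSpace.exp (t • x)

/-- The circumradius of `A` in `M` with the distance `d`: the infimum of the radii of the
closed balls with center in `M` that contain `A`. -/
noncomputable def circumradius {X : Type*} (d : X → X → ℝ) (M A : Set X) : ℝ :=
  sInf {r : ℝ | ∃ c ∈ M, ∀ a ∈ A, d c a ≤ r}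

/-- `c` is a circumcenter of `A` in `M` with the distance `d`: it is the center of a closed ball
that contains `A` and has minimal radius among all closed balls with center in `M`
that contain `A`. -/
def IsCircumcenter {X : Type*} (d : X → X → ℝ) (M A : Set X) (c : X) : Prop :=
  c ∈ M ∧ ∃ r : ℝ, (∀ a ∈ A, d c a ≤ r) ∧
    ∀ c' ∈ M, ∀ r' : ℝ, (∀ a ∈ A, d c' a ≤ r') → r ≤ r'

end FinslerUnitary

/-!
Why the theorem is true.  A unitary matrix `W` is `E diag(e^{iθ}) E^*` with principal angles
`θ_j ∈ (-π, π]`.  Put `energy p W = ∑ θ_j ^ p` and `angleNorm p W = (energy p W) ^ (1/p)`.  Two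
estimates on the energy carry the proof.  Both are *Klein inequalities*: for two unitary matrices
`W = E diag(e^{iη}) E^*` and `Z = G diag(e^{iθ}) G^*` the numbers `|⟨e_i, g_j⟩|²` form a doubly
stochastic matrix (`overlap`), so that an inequality between functions of two points of the circle,
averaged against it, becomes an inequality between traces.  No perturbation theory of eigenvalues is
needed.

* `exists_energy_le`: `θ ^ p` is semiconcave on the whole circle, the kink at the cut point `-1`
  being concave; hence `energy p W` is at most its first order expansion at `Z` plus
  `C ‖W - Z‖²`.  With Hölder's inequality for the first order term
  (`abs_im_trace_mul_energyGrad_le`) this bounds the growth of `angleNorm p` along any piecewise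
  smooth curve by the length of the curve, whether or not the curve meets the cut locus
  (`angleNorm_le_curveLength`).  As `t ↦ u E diag(e^{itθ}) E^*` attains the bound,
  `d_p(u, v) = angleNorm p (u⁻¹ v)`; the interior distance of a geodesic set has the same value as
  soon as all angles of `u⁻¹ v` are smaller than `π` in absolute value.

* `energy_add_le`: for angles in `(-π/2, π/2)` one has
  `θ ^ p + p θ ^ (p-1) sin (η - θ) ≤ η ^ p`, with equality only for `η = θ`.  So the energy is
  bounded below by its first order expansion.  If `Z` is the midpoint of the geodesic from `W` to
  `W'`, then `W + W'` is a positive matrix times `Z`; the first order terms at `Z` therefore cancel,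
  and `energy p Z < (energy p W + energy p W') / 2` unless `W = W'` (`energy_midpoint_lt`).  The
  same positive factor shows that the angles of `Z` stay in `(-π/2, π/2)`.

The function `c ↦ max_{a ∈ A} angleNorm p (c⁻¹ a)` is continuous and attains its minimum on the
compact set `M`.  When the minimum is less than `π/2` the minimizers are the circumcenters for
either distance, and the midpoint of two of them would lie in `M` and have a smaller value
(`existsUnique_isCircumcenter`).
-/

namespace FinslerUnitary

open Set Filter
open scoped Matrix ContDiff Topology

/-! ### Spectral resolutions of unitary matrices -/

section
open scoped Matrix.Norms.L2Operator
/-- A unitary matrix has a Hermitian logarithm: its spectrum is finite, so that the discontinuity of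
`Complex.arg` does not matter to the continuous functional calculus. -/
theorem exists_isHermitian_exp_eq {n : ℕ} (W : U n) :
    ∃ H : Matrix (Fin n) (Fin n) ℂ, H.IsHermitian ∧
      NormedSpace.exp (Complex.I • H) = (W : Matrix (Fin n) (Fin n) ℂ) := by
  set w : Matrix (Fin n) (Fin n) ℂ := W.1 with hw
  have hn : IsStarNormal w := ⟨by
    have h1 := W.2.1
    have h2 := W.2.2
    exact h1.trans h2.symm⟩
  have hfin : (spectrum ℂ w).Finite := Matrix.finite_spectrum w
  have hc : ContinuousOn (fun z : ℂ => (Complex.arg z : ℂ)) (spectrum ℂ w) := hfin.continuousOn _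
  refine ⟨cfc (fun z : ℂ => (Complex.arg z : ℂ)) w, ?_, ?_⟩
  · change star _ = _
    rw [← cfc_star]
    simp
  · rw [← cfc_smul .., ← CFC.complex_exp_eq_normedSpace_exp, ← cfc_comp' ..]
    conv_rhs => rw [← cfc_id' ℂ w]
    refine cfc_congr fun y hy => ?_
    have h1 : ‖y‖ = 1 := by
      have := spectrum.subset_circle_of_unitary W.2 hy
      simpa using this
    simp only [smul_eq_mul, mul_comm Complex.I]
    have := Complex.norm_mul_exp_arg_mul_I y
    rw [h1] at this; simpa using this
end

/-- The matrix with orthonormal eigenbasis the columns of `E` and eigenvalues `k`. -/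
noncomputable def specMat {n : ℕ} (E : U n) (k : Fin n → ℂ) : Matrix (Fin n) (Fin n) ℂ :=
  E.1 * Matrix.diagonal k * E.1ᴴ

theorem conjTranspose_mul_self {n : ℕ} (E : U n) : E.1ᴴ * E.1 = 1 := E.2.1

theorem mul_conjTranspose_self {n : ℕ} (E : U n) : E.1 * E.1ᴴ = 1 := E.2.2

theorem specMat_mul {n : ℕ} (E : U n) (k l : Fin n → ℂ) :
    specMat E k * specMat E l = specMat E (k * l) := by
  unfold specMat
  calc _ = E.1 * Matrix.diagonal k * (E.1ᴴ * E.1) * Matrix.diagonal l * E.1ᴴ := by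
        simp only [mul_assoc]
    _ = _ := by
        rw [conjTranspose_mul_self, mul_one, mul_assoc E.1, Matrix.diagonal_mul_diagonal]; rfl

theorem specMat_one {n : ℕ} (E : U n) : specMat E 1 = 1 := by
  unfold specMat
  rw [show (Matrix.diagonal (1 : Fin n → ℂ)) = 1 from Matrix.diagonal_one, mul_one,
    mul_conjTranspose_self]

theorem specMat_pow {n : ℕ} (E : U n) (k : Fin n → ℂ) (m : ℕ) :
    specMat E k ^ m = specMat E (k ^ m) := by
  induction m with
  | zero => simp [specMat_one]
  | succ m ih => rw [pow_succ, ih, specMat_mul, pow_succ]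

theorem specMat_conjTranspose {n : ℕ} (E : U n) (k : Fin n → ℂ) :
    (specMat E k)ᴴ = specMat E (star k) := by
  simp [specMat, Matrix.conjTranspose_mul, Matrix.diagonal_conjTranspose, mul_assoc]

theorem specMat_smul {n : ℕ} (E : U n) (c : ℂ) (k : Fin n → ℂ) :
    c • specMat E k = specMat E (c • k) := by
  simp [specMat, Matrix.diagonal_smul]

theorem specMat_add {n : ℕ} (E : U n) (k l : Fin n → ℂ) :
    specMat E k + specMat E l = specMat E (k + l) := by
  unfold specMat
  rw [← add_mul, ← mul_add, Matrix.diagonal_add]; rfl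

theorem trace_specMat {n : ℕ} (E : U n) (k : Fin n → ℂ) : (specMat E k).trace = ∑ i, k i := by
  rw [specMat, Matrix.trace_mul_comm, ← mul_assoc, conjTranspose_mul_self, one_mul,
    Matrix.trace_diagonal]

theorem exp_specMat {n : ℕ} (E : U n) (k : Fin n → ℂ) :
    NormedSpace.exp (specMat E k) = specMat E (fun j => Complex.exp (k j)) := by
  have h := Matrix.exp_units_conj (𝔸 := ℂ) (Unitary.toUnits E) (Matrix.diagonal k)
  have e : NormedSpace.exp (Matrix.diagonal k)
      = Matrix.diagonal (fun j => Complex.exp (k j)) := by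
    rw [Matrix.exp_diagonal]
    congr 1; ext j
    rw [Pi.exp_def, Complex.exp_eq_exp_ℂ]
  rw [e] at h
  exact h

/-- The unitary matrix `E diag(e^{iθ}) E^*`. -/
noncomputable def expMat {n : ℕ} (E : U n) (θ : Fin n → ℝ) : Matrix (Fin n) (Fin n) ℂ :=
  specMat E fun j => Complex.exp (θ j * Complex.I)

/-- Every unitary matrix is `E diag(e^{iθ}) E^*` with `E` unitary and principal angles `θ`. -/
theorem exists_eq_expMat {n : ℕ} (W : U n) :
    ∃ (E : U n) (θ : Fin n → ℝ), W.1 = expMat E θ ∧ ∀ j, θ j ∈ Ioc (-Real.pi) Real.pi := by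
  obtain ⟨H, hH, hW⟩ := exists_isHermitian_exp_eq W
  refine ⟨hH.eigenvectorUnitary,
    fun j => Complex.arg (Complex.exp (hH.eigenvalues j * Complex.I)), ?_,
    fun j => Complex.arg_mem_Ioc _⟩
  have hs : H = specMat hH.eigenvectorUnitary (fun j => (hH.eigenvalues j : ℂ)) :=
    hH.spectral_theorem
  rw [← hW]
  conv_lhs => rw [hs]
  rw [specMat_smul, exp_specMat, expMat]
  congr 1
  ext j
  have := Complex.norm_mul_exp_arg_mul_I (Complex.exp (hH.eigenvalues j * Complex.I))
  rw [Complex.norm_exp_ofReal_mul_I] at this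
  simp only [Complex.ofReal_one, one_mul] at this
  rw [this]
  simp [mul_comm]

/-! ### Scalar inequalities on the circle -/

/-- The sharp quadratic bound, with equality at `0` and `π`, that makes `π / 2` the right bound on
the angles. -/
theorem sub_sin_lt_sq_div_pi {x : ℝ} (hx0 : 0 < x) (hx : x < Real.pi) :
    x - Real.sin x < x ^ 2 / Real.pi := by
  have hpi := Real.pi_pos
  have hpi4 := Real.pi_lt_four
  -- both sides are compatible with `x ↦ π - x`, so it suffices to treat `x ≤ π / 2`
  have key : ∀ y : ℝ, 0 < y → y ≤ Real.pi / 2 → y - Real.sin y < y ^ 2 / Real.pi := by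
    intro y hy0 hy
    have h1 := Real.sin_gt_sub_cube hy0
    have h2 : y ^ 3 / 6 ≤ y ^ 2 / Real.pi := by
      rw [div_le_div_iff₀ (by norm_num) hpi]
      nlinarith [mul_nonneg (sq_nonneg y) (show 0 ≤ 6 - y * Real.pi by
        nlinarith [Real.pi_lt_d2])]
    linarith
  rcases le_total x (Real.pi / 2) with h | h
  · exact key x hx0 h
  · have := key (Real.pi - x) (by linarith) (by linarith)
    rw [Real.sin_pi_sub] at this
    have e : (Real.pi - x) ^ 2 / Real.pi = Real.pi - 2 * x + x ^ 2 / Real.pi := by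
      field_simp; ring
    linarith

theorem two_mul_mul_sin_sub_lt {x y : ℝ} (hx : |x| < Real.pi / 2) (hy : |y| < Real.pi / 2)
    (hxy : x ≠ y) : 2 * x * Real.sin (y - x) < y ^ 2 - x ^ 2 := by
  have hpi := Real.pi_pos
  have key : ∀ d c : ℝ, 0 < d → d < Real.pi → |c| < Real.pi / 2 →
      2 * c * Real.sin d < d ^ 2 + 2 * c * d := by
    intro d c hd0 hd hc
    have h1 := sub_sin_lt_sq_div_pi hd0 hd
    have h2 := Real.sin_lt hd0
    rw [lt_div_iff₀ hpi] at h1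
    have h3 := (abs_lt.1 hc).1
    nlinarith
  rw [abs_lt] at hx hy
  rcases lt_or_gt_of_ne hxy with h | h
  · have := key (y - x) x (by linarith) (by linarith) (abs_lt.2 hx)
    nlinarith
  · have := key (x - y) (-x) (by linarith) (by linarith) (by rw [abs_neg]; exact abs_lt.2 hx)
    rw [show y - x = -(x - y) by ring, Real.sin_neg]
    nlinarith

/-- The even powers of the angle are convex along geodesics, compared with their first order
expansion in the ambient space, as long as the angles stay in `(-π/2, π/2)`. -/
theorem pow_add_mul_sin_lt_pow {p : ℕ} (hp : Even p) (hp2 : 2 ≤ p) {x y : ℝ}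
    (hx : |x| < Real.pi / 2) (hy : |y| < Real.pi / 2) (hxy : x ≠ y) :
    x ^ p + p * x ^ (p - 1) * Real.sin (y - x) < y ^ p := by
  rcases eq_or_ne x 0 with rfl | hx0
  · have : 0 < y ^ p := hp.pow_pos hxy.symm
    simpa [zero_pow (show p ≠ 0 by omega), zero_pow (show p - 1 ≠ 0 by omega)] using this
  obtain ⟨q, rfl⟩ := hp
  have h := two_mul_mul_sin_sub_lt hx hy hxy
  obtain ⟨q, rfl⟩ : ∃ r, q = r + 1 := ⟨q - 1, by omega⟩
  have hxx : 0 < x ^ 2 := by positivity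
  -- Bernoulli's inequality reduces the claim to the exponent `2`
  have hb := one_add_mul_le_pow (a := y ^ 2 / x ^ 2 - 1)
    (by have : 0 ≤ y ^ 2 / x ^ 2 := by positivity
        linarith) (q + 1)
  rw [add_sub_cancel, div_pow, le_div_iff₀ (by positivity)] at hb
  have e : (1 + ((q + 1 : ℕ) : ℝ) * (y ^ 2 / x ^ 2 - 1)) * (x ^ 2) ^ (q + 1)
      = (x ^ 2) ^ (q + 1) + (q + 1) * (x ^ 2) ^ q * (y ^ 2 - x ^ 2) := by
    push_cast
    rw [pow_succ (x ^ 2) q]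
    field_simp
  rw [e] at hb
  have h2 : (q + 1) * (x ^ 2) ^ q * (2 * x * Real.sin (y - x)) <
      (q + 1) * (x ^ 2) ^ q * (y ^ 2 - x ^ 2) := by
    have : (0 : ℝ) < (q + 1) * (x ^ 2) ^ q := by positivity
    exact mul_lt_mul_of_pos_left h this
  have e1 : x ^ (q + 1 + (q + 1)) = (x ^ 2) ^ (q + 1) := by rw [← pow_mul]; congr 1; ring
  have e2 : y ^ (q + 1 + (q + 1)) = (y ^ 2) ^ (q + 1) := by rw [← pow_mul]; congr 1; ring
  have e3 : x ^ (q + 1 + (q + 1) - 1) = (x ^ 2) ^ q * x := by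
    rw [← pow_mul, ← pow_succ]; congr 1; omega
  rw [e1, e2, e3]
  push_cast
  linarith

theorem exists_abs_add_pow_sub_le (p : ℕ) : ∃ C : ℝ, 0 ≤ C ∧ ∀ x d : ℝ, |x| ≤ Real.pi →
    |d| ≤ Real.pi → |(x + d) ^ p - x ^ p - p * x ^ (p - 1) * d| ≤ C * d ^ 2 := by
  induction p with
  | zero => exact ⟨0, le_rfl, by simp⟩
  | succ p ih =>
    obtain ⟨C, hC, h⟩ := ih
    refine ⟨2 * Real.pi * C + p * Real.pi ^ (p - 1), by positivity, fun x d hx hd => ?_⟩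
    have e : (x + d) ^ (p + 1) - x ^ (p + 1) - ((p + 1 : ℕ) : ℝ) * x ^ (p + 1 - 1) * d =
        (x + d) * ((x + d) ^ p - x ^ p - p * x ^ (p - 1) * d) + p * x ^ (p - 1) * d ^ 2 := by
      rcases p with _ | p
      · simp
      · push_cast
        ring
    rw [e]
    have h1 : |(x + d) * ((x + d) ^ p - x ^ p - p * x ^ (p - 1) * d)| ≤
        2 * Real.pi * (C * d ^ 2) := by
      rw [abs_mul]
      exact mul_le_mul (by linarith [abs_add_le x d]) (h x d hx hd) (abs_nonneg _) (by positivity)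
    have h2 : |p * x ^ (p - 1) * d ^ 2| ≤ p * Real.pi ^ (p - 1) * d ^ 2 := by
      rw [abs_mul, abs_mul, abs_pow, Nat.abs_cast, abs_of_nonneg (sq_nonneg d)]
      gcongr
    refine (abs_add_le _ _).trans ?_
    linarith

/-- Even powers of the angle are semiconcave on the whole circle: at the cut point `-1` they have
a kink, but a concave one. -/
theorem exists_pow_le_add_mul_sin {p : ℕ} (hp : Even p) : ∃ C : ℝ, 0 ≤ C ∧ ∀ x y : ℝ,
    |x| ≤ Real.pi → |y| ≤ Real.pi →
    y ^ p ≤ x ^ p + p * x ^ (p - 1) * Real.sin (y - x) + C * (1 - Real.cos (y - x)) := by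
  obtain ⟨C, hC, h⟩ := exists_abs_add_pow_sub_le p
  have hpi := Real.pi_pos
  set D := C + p * Real.pi ^ (p - 1) * 2 with hD
  have hD0 : 0 ≤ D := by positivity
  refine ⟨D * (Real.pi ^ 2 / 2), by positivity, fun x y hx hy => ?_⟩
  -- `d` is `y - x` reduced modulo `2π`; passing from `y` to `x + d` can only increase `|y|`
  have key : ∀ d : ℝ, |d| ≤ Real.pi → |y| ≤ |x + d| →
      y ^ p ≤ x ^ p + p * x ^ (p - 1) * Real.sin d
        + D * (Real.pi ^ 2 / 2) * (1 - Real.cos d) := by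
    intro d hd hyd
    have h1 : y ^ p ≤ (x + d) ^ p := by
      rw [← hp.pow_abs y, ← hp.pow_abs (x + d)]
      exact pow_le_pow_left₀ (abs_nonneg _) hyd _
    have h2 := (abs_le.1 (h x d hx hd)).2
    have h3 : |p * x ^ (p - 1) * (d - Real.sin d)| ≤ p * Real.pi ^ (p - 1) * (2 * d ^ 2) := by
      rw [abs_mul, abs_mul, abs_pow, Nat.abs_cast]
      gcongr
      refine (Real.abs_sub_sin_le d).trans ?_
      rw [← sq_abs d]
      nlinarith [mul_nonneg (sq_nonneg |d|) (sub_nonneg.2 hd), Real.pi_le_four, sq_nonneg |d|]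
    have h4 := (abs_le.1 h3).2
    have h5 := Real.cos_le_one_sub_mul_cos_sq hd
    have h6 : d ^ 2 ≤ Real.pi ^ 2 / 2 * (1 - Real.cos d) := by
      have e : Real.pi ^ 2 / 2 * (2 / Real.pi ^ 2 * d ^ 2) = d ^ 2 := by field_simp
      calc d ^ 2 = Real.pi ^ 2 / 2 * (2 / Real.pi ^ 2 * d ^ 2) := e.symm
        _ ≤ _ := by gcongr; linarith
    have h7 := mul_le_mul_of_nonneg_left h6 hD0
    have h8 : D * d ^ 2 = C * d ^ 2 + p * Real.pi ^ (p - 1) * (2 * d ^ 2) := by rw [hD]; ring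
    nlinarith
  have hx' := abs_le.1 hx
  have hy' := abs_le.1 hy
  rcases lt_or_ge Real.pi (y - x) with h1 | h1
  · have := key (y - x - 2 * Real.pi) (abs_le.2 ⟨by linarith, by linarith⟩) (by
      rw [show x + (y - x - 2 * Real.pi) = -(2 * Real.pi - y) by ring, abs_neg]
      rw [abs_of_nonneg (by linarith : (0:ℝ) ≤ 2 * Real.pi - y)]; linarith)
    rwa [Real.sin_sub_two_pi, Real.cos_sub_two_pi] at this
  · rcases lt_or_ge (y - x) (-Real.pi) with h2 | h2
    · have := key (y - x + 2 * Real.pi) (abs_le.2 ⟨by linarith, by linarith⟩) (by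
        rw [show x + (y - x + 2 * Real.pi) = 2 * Real.pi + y by ring]
        rw [abs_of_nonneg (by linarith : (0:ℝ) ≤ 2 * Real.pi + y)]; linarith)
      rwa [Real.sin_add_two_pi, Real.cos_add_two_pi] at this
    · exact key (y - x) (abs_le.2 ⟨h2, h1⟩) (by rw [add_sub_cancel])

/-! ### Doubly stochastic overlaps and trace formulas -/

/-- The doubly stochastic matrix of squared overlaps `|⟨e_i, g_j⟩|²` of two orthonormal bases. -/
noncomputable def overlap {n : ℕ} (E G : U n) (i j : Fin n) : ℝ :=
  Complex.normSq ((E.1ᴴ * G.1) i j)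

theorem overlap_nonneg {n : ℕ} (E G : U n) (i j : Fin n) : 0 ≤ overlap E G i j :=
  Complex.normSq_nonneg _

theorem overlap_comm {n : ℕ} (E G : U n) (i j : Fin n) : overlap E G i j = overlap G E j i := by
  unfold overlap
  have : E.1ᴴ * G.1 = (G.1ᴴ * E.1)ᴴ := by simp [Matrix.conjTranspose_mul]
  rw [this, Matrix.conjTranspose_apply]
  exact Complex.normSq_conj _

theorem conj_specMat_apply {n : ℕ} (E G : U n) (k : Fin n → ℂ) (j : Fin n) :
    (G.1ᴴ * specMat E k * G.1) j j = ∑ i, k i * overlap E G i j := by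
  have h : G.1ᴴ * specMat E k * G.1 = (E.1ᴴ * G.1)ᴴ * (Matrix.diagonal k * (E.1ᴴ * G.1)) := by
    simp [specMat, Matrix.conjTranspose_mul, mul_assoc]
  rw [h, Matrix.mul_apply]
  refine Finset.sum_congr rfl fun i _ => ?_
  rw [Matrix.diagonal_mul, Matrix.conjTranspose_apply, overlap, Complex.normSq_eq_conj_mul_self]
  change star _ * _ = _ * (star _ * _)
  ring

theorem trace_mul_specMat {n : ℕ} (A : Matrix (Fin n) (Fin n) ℂ) (G : U n) (h : Fin n → ℂ) :
    (A * specMat G h).trace = ∑ j, (G.1ᴴ * A * G.1) j j * h j := by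
  have e : A * specMat G h = (A * G.1 * Matrix.diagonal h) * G.1ᴴ := by
    simp [specMat, mul_assoc]
  rw [e, Matrix.trace_mul_comm, ← mul_assoc, ← mul_assoc]
  simp [Matrix.trace]

theorem trace_specMat_mul_specMat {n : ℕ} (E G : U n) (k h : Fin n → ℂ) :
    (specMat E k * specMat G h).trace = ∑ j, ∑ i, k i * h j * overlap E G i j := by
  rw [trace_mul_specMat]
  refine Finset.sum_congr rfl fun j _ => ?_
  rw [conj_specMat_apply, Finset.sum_mul]
  exact Finset.sum_congr rfl fun i _ => by ring

theorem sum_overlap_left {n : ℕ} (E G : U n) (j : Fin n) : ∑ i, overlap E G i j = 1 := by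
  have h := conj_specMat_apply E G 1 j
  rw [specMat_one, mul_one, conjTranspose_mul_self, Matrix.one_apply_eq] at h
  simp only [Pi.one_apply, one_mul] at h
  exact_mod_cast h.symm

theorem sum_overlap_right {n : ℕ} (E G : U n) (i : Fin n) : ∑ j, overlap E G i j = 1 := by
  simp_rw [overlap_comm E G]
  exact sum_overlap_left G E i

/-- The square of the Frobenius norm. -/
noncomputable def frobSq {n : ℕ} (A : Matrix (Fin n) (Fin n) ℂ) : ℝ :=
  ∑ i, ∑ j, Complex.normSq (A i j)

theorem frobSq_eq_trace {n : ℕ} (A : Matrix (Fin n) (Fin n) ℂ) :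
    (frobSq A : ℂ) = (Aᴴ * A).trace := by
  unfold frobSq
  rw [Finset.sum_comm]
  push_cast
  simp only [Matrix.trace, Matrix.diag_apply, Matrix.mul_apply, Matrix.conjTranspose_apply,
    Complex.normSq_eq_conj_mul_self]
  rfl

theorem frobSq_conj {n : ℕ} (E G : U n) (A : Matrix (Fin n) (Fin n) ℂ) :
    frobSq (E.1ᴴ * A * G.1) = frobSq A := by
  have : (frobSq (E.1ᴴ * A * G.1) : ℂ) = frobSq A := by
    rw [frobSq_eq_trace, frobSq_eq_trace]
    have e : (E.1ᴴ * A * G.1)ᴴ * (E.1ᴴ * A * G.1) = G.1ᴴ * (Aᴴ * (E.1 * E.1ᴴ) * A * G.1) := by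
      simp [Matrix.conjTranspose_mul, mul_assoc]
    rw [e, mul_conjTranspose_self, mul_one, Matrix.trace_mul_comm G.1ᴴ,
      mul_assoc (Aᴴ * A), mul_conjTranspose_self, mul_one]
  exact_mod_cast this

theorem frobSq_neg {n : ℕ} (A : Matrix (Fin n) (Fin n) ℂ) : frobSq (-A) = frobSq A := by
  simp [frobSq]

theorem frobSq_zero {n : ℕ} : frobSq (0 : Matrix (Fin n) (Fin n) ℂ) = 0 := by
  simp [frobSq]

/-- The Klein trick for the squared distance. -/
theorem frobSq_specMat_sub {n : ℕ} (E G : U n) (w z : Fin n → ℂ) :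
    frobSq (specMat E w - specMat G z) =
      ∑ j, ∑ i, Complex.normSq (w i - z j) * overlap E G i j := by
  set A := specMat E w - specMat G z with hA
  have h2 : E.1ᴴ * A * G.1 =
      Matrix.diagonal w * (E.1ᴴ * G.1) - (E.1ᴴ * G.1) * Matrix.diagonal z := by
    rw [hA, mul_sub, sub_mul]
    congr 1
    · simp only [specMat, ← mul_assoc]
      rw [conjTranspose_mul_self, one_mul]
    · simp only [specMat, mul_assoc]
      rw [conjTranspose_mul_self, mul_one]
  rw [← frobSq_conj E G A, h2, frobSq, Finset.sum_comm]
  refine Finset.sum_congr rfl fun j _ => Finset.sum_congr rfl fun i _ => ?_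
  rw [Matrix.sub_apply, Matrix.diagonal_mul, Matrix.mul_diagonal, overlap, ← Complex.normSq_mul]
  congr 1; ring

theorem frobSq_eq_zero {n : ℕ} {A : Matrix (Fin n) (Fin n) ℂ} (h : frobSq A = 0) : A = 0 := by
  ext i j
  have h1 := (Finset.sum_eq_zero_iff_of_nonneg
    fun i _ => Finset.sum_nonneg fun j _ => Complex.normSq_nonneg (A i j)).1 h i
      (Finset.mem_univ _)
  exact Complex.normSq_eq_zero.1 ((Finset.sum_eq_zero_iff_of_nonneg
    fun j _ => Complex.normSq_nonneg (A i j)).1 h1 j (Finset.mem_univ _))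

theorem normSq_exp_sub_exp (x y : ℝ) :
    Complex.normSq (Complex.exp (y * Complex.I) - Complex.exp (x * Complex.I)) =
      2 * (1 - Real.cos (y - x)) := by
  rw [Complex.normSq_apply]
  simp only [Complex.sub_re, Complex.sub_im, Complex.exp_ofReal_mul_I_re,
    Complex.exp_ofReal_mul_I_im, Real.cos_sub]
  nlinarith [Real.sin_sq_add_cos_sq x, Real.sin_sq_add_cos_sq y]

/-- The derivative of `∑ θ_j ^ p` at `G diag(e^{iθ}) G^*` in the direction `A` is
`p * Im Tr (A * gradMat p G θ)`, as long as all `|θ_j| < π`. -/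
noncomputable def gradMat {n : ℕ} (p : ℕ) (G : U n) (θ : Fin n → ℝ) :
    Matrix (Fin n) (Fin n) ℂ :=
  specMat G fun j => (θ j ^ (p - 1) : ℝ) * Complex.exp (-θ j * Complex.I)

theorem im_trace_expMat_mul_gradMat {n : ℕ} (p : ℕ) (E G : U n) (η θ : Fin n → ℝ) :
    (expMat E η * gradMat p G θ).trace.im =
      ∑ j, ∑ i, θ j ^ (p - 1) * Real.sin (η i - θ j) * overlap E G i j := by
  rw [expMat, gradMat, trace_specMat_mul_specMat, Complex.im_sum]
  refine Finset.sum_congr rfl fun j _ => ?_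
  rw [Complex.im_sum]
  refine Finset.sum_congr rfl fun i _ => ?_
  have : Complex.exp (η i * Complex.I) * ((θ j ^ (p - 1) : ℝ) *
      Complex.exp (-θ j * Complex.I)) * overlap E G i j =
      ((θ j ^ (p - 1) * overlap E G i j : ℝ) : ℂ) *
        Complex.exp ((η i - θ j : ℝ) * Complex.I) := by
    have : Complex.exp ((η i - θ j : ℝ) * Complex.I) =
        Complex.exp (η i * Complex.I) * Complex.exp (-θ j * Complex.I) := by
      rw [← Complex.exp_add]; congr 1; push_cast; ring
    rw [this]; push_cast; ring
  rw [this, Complex.im_ofReal_mul, Complex.exp_ofReal_mul_I_im]; ring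

/-! ### Klein inequalities for the energy -/

theorem sum_overlap_sub {n : ℕ} (E G : U n) (a b : Fin n → ℝ) :
    ∑ j, ∑ i, (a i - b j) * overlap E G i j = ∑ i, a i - ∑ j, b j := by
  simp_rw [sub_mul, Finset.sum_sub_distrib]
  congr 1
  · rw [Finset.sum_comm]
    simp_rw [← Finset.mul_sum, sum_overlap_right, mul_one]
  · simp_rw [← Finset.mul_sum, sum_overlap_left, mul_one]

theorem frobSq_expMat_sub {n : ℕ} (E G : U n) (η θ : Fin n → ℝ) :
    frobSq (expMat E η - expMat G θ) =
      ∑ j, ∑ i, 2 * (1 - Real.cos (η i - θ j)) * overlap E G i j := by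
  simp_rw [expMat, frobSq_specMat_sub, normSq_exp_sub_exp]

theorem expMat_mul_gradMat {n : ℕ} (p : ℕ) (G : U n) (θ : Fin n → ℝ) :
    expMat G θ * gradMat p G θ = specMat G fun j => ((θ j ^ (p - 1) : ℝ) : ℂ) := by
  rw [expMat, gradMat, specMat_mul]
  congr 1
  ext j
  rw [Pi.mul_apply, mul_left_comm, ← Complex.exp_add]
  simp

theorem im_trace_expMat_mul_gradMat_self {n : ℕ} (p : ℕ) (G : U n) (θ : Fin n → ℝ) :
    (expMat G θ * gradMat p G θ).trace.im = 0 := by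
  rw [expMat_mul_gradMat, trace_specMat, Complex.im_sum]
  simp only [Complex.ofReal_im, Finset.sum_const_zero]

theorem im_trace_sub_mul_gradMat {n : ℕ} (p : ℕ) (E G : U n) (η θ : Fin n → ℝ) :
    ((expMat E η - expMat G θ) * gradMat p G θ).trace.im =
      ∑ j, ∑ i, θ j ^ (p - 1) * Real.sin (η i - θ j) * overlap E G i j := by
  rw [sub_mul, Matrix.trace_sub, Complex.sub_im, im_trace_expMat_mul_gradMat_self, sub_zero,
    im_trace_expMat_mul_gradMat]

/-- Semiconcavity of the sum of the `p`-th powers of the angles. -/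
theorem exists_sum_pow_le {p : ℕ} (hp : Even p) : ∃ C : ℝ, 0 ≤ C ∧
    ∀ (n : ℕ) (E G : U n) (η θ : Fin n → ℝ), (∀ j, |η j| ≤ Real.pi) → (∀ j, |θ j| ≤ Real.pi) →
    ∑ j, η j ^ p ≤ ∑ j, θ j ^ p +
      p * ((expMat E η - expMat G θ) * gradMat p G θ).trace.im +
      C * frobSq (expMat E η - expMat G θ) := by
  obtain ⟨C, hC, h⟩ := exists_pow_le_add_mul_sin hp
  refine ⟨C / 2, by positivity, fun n E G η θ hη hθ => ?_⟩
  rw [im_trace_sub_mul_gradMat, frobSq_expMat_sub]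
  have h1 := sum_overlap_sub E G (fun i => η i ^ p) (fun j => θ j ^ p)
  suffices ∑ j, ∑ i, (η i ^ p - θ j ^ p) * overlap E G i j ≤
      p * (∑ j, ∑ i, θ j ^ (p - 1) * Real.sin (η i - θ j) * overlap E G i j) +
      C / 2 * ∑ j, ∑ i, 2 * (1 - Real.cos (η i - θ j)) * overlap E G i j by linarith
  simp_rw [Finset.mul_sum, ← Finset.sum_add_distrib]
  refine Finset.sum_le_sum fun j _ => Finset.sum_le_sum fun i _ => ?_
  have h2 := mul_le_mul_of_nonneg_right (h (θ j) (η i) (hθ j) (hη i)) (overlap_nonneg E G i j)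
  linarith

/-- Convexity of the sum of the `p`-th powers of the angles, for angles in `(-π/2, π/2)`. -/
theorem sum_pow_add_le {n p : ℕ} (hp : Even p) (hp2 : 2 ≤ p) (E G : U n) {η θ : Fin n → ℝ}
    (hη : ∀ j, |η j| < Real.pi / 2) (hθ : ∀ j, |θ j| < Real.pi / 2) :
    ∑ j, θ j ^ p + p * ((expMat E η - expMat G θ) * gradMat p G θ).trace.im ≤ ∑ j, η j ^ p ∧
    (∑ j, θ j ^ p + p * ((expMat E η - expMat G θ) * gradMat p G θ).trace.im = ∑ j, η j ^ p →
      expMat E η = expMat G θ) := by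
  rw [im_trace_sub_mul_gradMat]
  have h1 := sum_overlap_sub E G (fun i => η i ^ p) (fun j => θ j ^ p)
  set φ : Fin n → Fin n → ℝ := fun j i =>
    (η i ^ p - (θ j ^ p + p * θ j ^ (p - 1) * Real.sin (η i - θ j))) * overlap E G i j with hφ
  have h2 : ∑ j, ∑ i, φ j i = ∑ j, η j ^ p - (∑ j, θ j ^ p +
      p * ∑ j, ∑ i, θ j ^ (p - 1) * Real.sin (η i - θ j) * overlap E G i j) := by
    rw [← sub_sub, ← h1]
    simp_rw [Finset.mul_sum, ← Finset.sum_sub_distrib]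
    refine Finset.sum_congr rfl fun j _ => Finset.sum_congr rfl fun i _ => ?_
    rw [hφ]; ring
  have h3 : ∀ j i, 0 ≤ φ j i := fun j i => by
    refine mul_nonneg ?_ (overlap_nonneg _ _ _ _)
    rcases eq_or_ne (θ j) (η i) with h | h
    · simp [h]
    · linarith [pow_add_mul_sin_lt_pow hp hp2 (hθ j) (hη i) h]
  have h4 : 0 ≤ ∑ j, ∑ i, φ j i :=
    Finset.sum_nonneg fun j _ => Finset.sum_nonneg fun i _ => h3 j i
  refine ⟨by linarith, fun heq => ?_⟩
  have h5 : ∑ j, ∑ i, φ j i = 0 := by linarith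
  rw [Finset.sum_eq_zero_iff_of_nonneg
    fun j _ => Finset.sum_nonneg fun i _ => h3 j i] at h5
  have h6 : frobSq (expMat E η - expMat G θ) = 0 := by
    rw [frobSq_expMat_sub]
    refine Finset.sum_eq_zero fun j hj => Finset.sum_eq_zero fun i hi => ?_
    have h7 := (Finset.sum_eq_zero_iff_of_nonneg fun i _ => h3 j i).1 (h5 j hj) i hi
    rcases eq_or_ne (θ j) (η i) with h | h
    · simp [h]
    · rcases mul_eq_zero.1 h7 with h8 | h8
      · linarith [pow_add_mul_sin_lt_pow hp hp2 (hθ j) (hη i) h]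
      · simp [h8]
  exact sub_eq_zero.1 (frobSq_eq_zero h6)

/-- An orthonormal eigenbasis of a unitary matrix. -/
noncomputable def frame {n : ℕ} (W : U n) : U n := (exists_eq_expMat W).choose

/-- The principal angles, in `(-π, π]`, of a unitary matrix, in the order of `frame W`. -/
noncomputable def angles {n : ℕ} (W : U n) : Fin n → ℝ := (exists_eq_expMat W).choose_spec.choose

theorem eq_expMat {n : ℕ} (W : U n) : W.1 = expMat (frame W) (angles W) :=
  (exists_eq_expMat W).choose_spec.choose_spec.1

theorem angles_mem {n : ℕ} (W : U n) (j : Fin n) : angles W j ∈ Ioc (-Real.pi) Real.pi :=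
  (exists_eq_expMat W).choose_spec.choose_spec.2 j

theorem abs_angles_le {n : ℕ} (W : U n) (j : Fin n) : |angles W j| ≤ Real.pi :=
  abs_le.2 ⟨(angles_mem W j).1.le, (angles_mem W j).2⟩

/-- The sum of the `p`-th powers of the principal angles of a unitary matrix, that is, the `p`-th
power of the `p`-distance from the identity. -/
noncomputable def energy {n : ℕ} (p : ℕ) (W : U n) : ℝ := ∑ j, angles W j ^ p

theorem energy_nonneg {n p : ℕ} (hp : Even p) (W : U n) : 0 ≤ energy p W :=
  Finset.sum_nonneg fun _ _ => hp.pow_nonneg _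

/-- The gradient of the energy at `Z`, up to the factor `p`. -/
noncomputable def energyGrad {n : ℕ} (p : ℕ) (Z : U n) : Matrix (Fin n) (Fin n) ℂ :=
  gradMat p (frame Z) (angles Z)

/-- The value of the energy does not depend on the choice of the spectral resolution. -/
theorem energy_eq {n p : ℕ} (hp : Even p) {W : U n} {E : U n} {η : Fin n → ℝ}
    (h : W.1 = expMat E η) (hη : ∀ j, |η j| ≤ Real.pi) : energy p W = ∑ j, η j ^ p := by
  obtain ⟨C, -, hC⟩ := exists_sum_pow_le hp
  have e : expMat E η = expMat (frame W) (angles W) := by rw [← h, ← eq_expMat]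
  have h1 := hC n E (frame W) η (angles W) hη (abs_angles_le W)
  have h2 := hC n (frame W) E (angles W) η (abs_angles_le W) hη
  rw [e] at h1 h2
  simp only [sub_self, zero_mul, Matrix.trace_zero, Complex.zero_im, mul_zero, add_zero,
    frobSq_zero] at h1 h2
  exact le_antisymm h2 h1

theorem exists_energy_le {p : ℕ} (hp : Even p) : ∃ C : ℝ, 0 ≤ C ∧ ∀ (n : ℕ) (W Z : U n),
    energy p W ≤ energy p Z + p * ((W.1 - Z.1) * energyGrad p Z).trace.im +
      C * frobSq (W.1 - Z.1) := by
  obtain ⟨C, h0, hC⟩ := exists_sum_pow_le hp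
  refine ⟨C, h0, fun n W Z => ?_⟩
  rw [eq_expMat W, eq_expMat Z]
  exact hC n _ _ _ _ (abs_angles_le W) (abs_angles_le Z)

theorem energy_add_le {n p : ℕ} (hp : Even p) (hp2 : 2 ≤ p) {W Z : U n}
    (hW : ∀ j, |angles W j| < Real.pi / 2) (hZ : ∀ j, |angles Z j| < Real.pi / 2) :
    energy p Z + p * ((W.1 - Z.1) * energyGrad p Z).trace.im ≤ energy p W ∧
    (energy p Z + p * ((W.1 - Z.1) * energyGrad p Z).trace.im = energy p W → W = Z) := by
  have h := sum_pow_add_le hp hp2 (frame W) (frame Z) hW hZ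
  rw [← eq_expMat W, ← eq_expMat Z] at h
  exact ⟨h.1, fun e => Subtype.ext (h.2 e)⟩

theorem norm_conj_apply_self_le {n : ℕ} (A : Matrix (Fin n) (Fin n) ℂ) (G : U n) (j : Fin n) :
    ‖(G.1ᴴ * A * G.1) j j‖ ≤ √(frobSq A) := by
  rw [← frobSq_conj G G A]
  refine Real.le_sqrt_of_sq_le ?_
  rw [← Complex.normSq_eq_norm_sq, frobSq]
  refine le_trans ?_ (Finset.single_le_sum
    (fun i _ => Finset.sum_nonneg fun k _ => Complex.normSq_nonneg _) (Finset.mem_univ j))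
  exact Finset.single_le_sum (f := fun k => Complex.normSq ((G.1ᴴ * A * G.1) j k))
    (fun k _ => Complex.normSq_nonneg _) (Finset.mem_univ j)

theorem abs_im_trace_mul_gradMat_le {n : ℕ} (p : ℕ) (A : Matrix (Fin n) (Fin n) ℂ) (G : U n)
    (θ : Fin n → ℝ) :
    |(A * gradMat p G θ).trace.im| ≤ ∑ j, |θ j| ^ (p - 1) * ‖(G.1ᴴ * A * G.1) j j‖ := by
  refine (Complex.abs_im_le_norm _).trans ?_
  rw [gradMat, trace_mul_specMat]
  refine (norm_sum_le _ _).trans (Finset.sum_le_sum fun j _ => le_of_eq ?_)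
  rw [norm_mul, norm_mul, ← Complex.ofReal_neg, Complex.norm_exp_ofReal_mul_I, mul_one,
    Complex.norm_real, norm_pow, Real.norm_eq_abs, mul_comm]

theorem continuous_energy {n p : ℕ} (hp : Even p) : Continuous (energy p : U n → ℝ) := by
  obtain ⟨C, hC0, hC⟩ := exists_energy_le hp
  have key : ∀ W Z : U n, |energy p W - energy p Z| ≤
      p * (n * (Real.pi ^ (p - 1) * √(frobSq (W.1 - Z.1)))) + C * frobSq (W.1 - Z.1) := by
    have aux : ∀ W Z : U n, energy p W - energy p Z ≤
        p * (n * (Real.pi ^ (p - 1) * √(frobSq (W.1 - Z.1)))) + C * frobSq (W.1 - Z.1) := by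
      intro W Z
      have h1 := hC n W Z
      have h2 := (le_abs_self _).trans
        (abs_im_trace_mul_gradMat_le p (W.1 - Z.1) (frame Z) (angles Z))
      have h3 : ∑ j, |angles Z j| ^ (p - 1) *
          ‖((frame Z).1ᴴ * (W.1 - Z.1) * (frame Z).1) j j‖ ≤
          n * (Real.pi ^ (p - 1) * √(frobSq (W.1 - Z.1))) := by
        refine (Finset.sum_le_card_nsmul _ _ _ fun j _ => mul_le_mul
          (pow_le_pow_left₀ (abs_nonneg _) (abs_angles_le Z j) _)
          (norm_conj_apply_self_le _ _ _) (norm_nonneg _) (by positivity)).trans_eq ?_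
        simp
      have h4 := mul_le_mul_of_nonneg_left (h2.trans h3) (Nat.cast_nonneg (α := ℝ) p)
      unfold energyGrad at h1
      linarith
    intro W Z
    refine abs_le.2 ⟨?_, aux W Z⟩
    have := aux Z W
    rw [← neg_sub W.1, frobSq_neg] at this
    linarith
  rw [continuous_iff_continuousAt]
  intro Z
  have hf : Continuous fun W : U n => frobSq (W.1 - Z.1) := by
    unfold frobSq
    refine continuous_finsetSum _ fun i _ => continuous_finsetSum _ fun j _ =>
      Complex.continuous_normSq.comp ?_
    exact ((continuous_subtype_val.sub continuous_const).matrix_elem i j)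
  have hc : Continuous fun W : U n =>
      p * (n * (Real.pi ^ (p - 1) * √(frobSq (W.1 - Z.1)))) + C * frobSq (W.1 - Z.1) := by
    fun_prop
  have h0 := hc.tendsto Z
  simp only [sub_self, frobSq_zero, Real.sqrt_zero, mul_zero, add_zero] at h0
  refine tendsto_iff_dist_tendsto_zero.2 (squeeze_zero (fun _ => dist_nonneg) (fun W => ?_) h0)
  exact key W Z

/-! ### Hölder's inequality for Schatten norms -/

open scoped ComplexOrder in
theorem exists_conjTranspose_mul_self_eq {n : ℕ} (A : Matrix (Fin n) (Fin n) ℂ) :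
    ∃ (S : U n) (s : Fin n → ℝ), (∀ i, 0 ≤ s i) ∧ Aᴴ * A = specMat S fun i => (s i : ℂ) := by
  have h := Matrix.posSemidef_conjTranspose_mul_self A
  exact ⟨h.1.eigenvectorUnitary, h.1.eigenvalues, h.eigenvalues_nonneg, h.1.spectral_theorem⟩

/-- The `p`-norm of the diagonal of a matrix in any orthonormal basis is at most the Schatten
`p`-norm: this is Jensen's inequality for the spectral measures of `Aᴴ * A`. -/
theorem sum_norm_conj_apply_self_pow_le {n p : ℕ} (hp : Even p)
    (A : Matrix (Fin n) (Fin n) ℂ) (G : U n) :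
    ∑ j, ‖(G.1ᴴ * A * G.1) j j‖ ^ p ≤ ((Aᴴ * A) ^ (p / 2)).trace.re := by
  obtain ⟨q, rfl⟩ := hp
  have hq : (q + q) / 2 = q := by omega
  obtain ⟨S, s, hs, hA⟩ := exists_conjTranspose_mul_self_eq A
  have h1 : ∀ j, ‖(G.1ᴴ * A * G.1) j j‖ ^ 2 ≤ ∑ i, overlap S G i j * s i := by
    intro j
    have e : G.1ᴴ * (Aᴴ * A) * G.1 = (G.1ᴴ * A * G.1)ᴴ * (G.1ᴴ * A * G.1) := by
      have : (G.1ᴴ * A * G.1)ᴴ * (G.1ᴴ * A * G.1) = G.1ᴴ * (Aᴴ * (G.1 * G.1ᴴ) * A) * G.1 := by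
        simp [Matrix.conjTranspose_mul, mul_assoc]
      rw [this, mul_conjTranspose_self, mul_one]
    have h2 := conj_specMat_apply S G (fun i => (s i : ℂ)) j
    rw [← hA, e, Matrix.mul_apply] at h2
    have h3 : ((∑ i, Complex.normSq ((G.1ᴴ * A * G.1) i j) : ℝ) : ℂ) =
        ((∑ i, overlap S G i j * s i : ℝ) : ℂ) := by
      push_cast
      simp only [mul_comm (overlap S G _ j : ℂ)]
      rw [← h2]
      refine Finset.sum_congr rfl fun i _ => ?_
      rw [Complex.normSq_eq_conj_mul_self]; rfl
    have h4 := Complex.ofReal_injective h3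
    rw [← h4, ← Complex.normSq_eq_norm_sq]
    exact Finset.single_le_sum (f := fun i => Complex.normSq ((G.1ᴴ * A * G.1) i j))
      (fun k _ => Complex.normSq_nonneg _) (Finset.mem_univ j)
  have h2 : ((Aᴴ * A) ^ ((q + q) / 2)).trace.re = ∑ i, s i ^ q := by
    rw [hA, specMat_pow, trace_specMat, hq, Complex.re_sum]
    refine Finset.sum_congr rfl fun i _ => ?_
    rw [Pi.pow_apply, ← Complex.ofReal_pow, Complex.ofReal_re]
  rw [h2]
  calc ∑ j, ‖(G.1ᴴ * A * G.1) j j‖ ^ (q + q)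
      ≤ ∑ j, ∑ i, overlap S G i j * s i ^ q := by
        refine Finset.sum_le_sum fun j _ => ?_
        rw [← two_mul, pow_mul]
        refine (pow_le_pow_left₀ (by positivity) (h1 j) q).trans ?_
        exact Real.pow_arith_mean_le_arith_mean_pow _ _ _ (fun i _ => overlap_nonneg _ _ _ _)
          (sum_overlap_left S G j) (fun i _ => hs i) q
    _ = ∑ i, s i ^ q := by
        rw [Finset.sum_comm]
        simp_rw [← Finset.sum_mul, sum_overlap_right, one_mul]

theorem trace_re_nonneg {n : ℕ} {p : ℕ} (hp : Even p) (A : Matrix (Fin n) (Fin n) ℂ) :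
    0 ≤ ((Aᴴ * A) ^ (p / 2)).trace.re :=
  (Finset.sum_nonneg fun _ _ => by positivity).trans (sum_norm_conj_apply_self_pow_le hp A 1)

theorem schattenNorm_nonneg {n : ℕ} {p : ℕ} (hp : Even p) (A : Matrix (Fin n) (Fin n) ℂ) :
    0 ≤ schattenNorm p A := Real.rpow_nonneg (trace_re_nonneg hp A) _

/-- The `p`-distance of a unitary matrix from the identity: the `p`-norm of the vector of its
principal angles. -/
noncomputable def angleNorm {n : ℕ} (p : ℕ) (W : U n) : ℝ := energy p W ^ (1 / (p : ℝ))

theorem angleNorm_nonneg {n p : ℕ} (hp : Even p) (W : U n) : 0 ≤ angleNorm p W :=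
  Real.rpow_nonneg (energy_nonneg hp W) _

theorem angleNorm_pow {n p : ℕ} (hp : Even p) (hp2 : 2 ≤ p) (W : U n) :
    angleNorm p W ^ p = energy p W := by
  rw [angleNorm, one_div, Real.rpow_inv_natCast_pow (energy_nonneg hp W) (by omega)]

/-- Hölder's inequality between the gradient of the energy and a tangent vector. -/
theorem abs_im_trace_mul_energyGrad_le {n p : ℕ} (hp : Even p) (hp2 : 2 ≤ p)
    (A : Matrix (Fin n) (Fin n) ℂ) (Z : U n) :
    |(A * energyGrad p Z).trace.im| ≤ angleNorm p Z ^ (p - 1) * schattenNorm p A := by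
  refine (abs_im_trace_mul_gradMat_le _ _ _ _).trans ?_
  have hp1 : (1 : ℝ) < p := by exact_mod_cast hp2
  have hp0 : (0 : ℝ) < p := by linarith
  have hpq : (p : ℝ).HolderConjugate ((p : ℝ) / (p - 1)) := Real.HolderConjugate.conjExponent hp1
  refine (Real.inner_le_Lp_mul_Lq_of_nonneg Finset.univ hpq.symm (fun j _ => by positivity)
    (fun j _ => norm_nonneg _)).trans ?_
  have e1 : ∀ j, (|angles Z j| ^ (p - 1)) ^ ((p : ℝ) / (p - 1)) = angles Z j ^ p := by
    intro j
    rw [← Real.rpow_natCast _ (p - 1), ← Real.rpow_mul (abs_nonneg _)]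
    have : ((p - 1 : ℕ) : ℝ) * (p / (p - 1)) = p := by
      rw [Nat.cast_sub (by omega)]
      push_cast
      have : (p : ℝ) - 1 ≠ 0 := by linarith
      field_simp
    rw [this, Real.rpow_natCast, hp.pow_abs]
  have e2 : (∑ j, angles Z j ^ p) ^ (1 / ((p : ℝ) / (p - 1))) = angleNorm p Z ^ (p - 1) := by
    rw [angleNorm, ← Real.rpow_natCast _ (p - 1), ← Real.rpow_mul (energy_nonneg hp Z), energy]
    congr 1
    rw [Nat.cast_sub (by omega)]
    push_cast
    field_simp
  simp_rw [e1, e2, Real.rpow_natCast]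
  refine mul_le_mul_of_nonneg_left ?_ (pow_nonneg (angleNorm_nonneg hp Z) _)
  exact Real.rpow_le_rpow (Finset.sum_nonneg fun _ _ => by positivity)
    (sum_norm_conj_apply_self_pow_le hp A _) (by positivity)

theorem schattenNorm_mul_left {n p : ℕ} (V : U n) (A : Matrix (Fin n) (Fin n) ℂ) :
    schattenNorm p (V.1 * A) = schattenNorm p A := by
  unfold schattenNorm
  have : (V.1 * A)ᴴ * (V.1 * A) = Aᴴ * (V.1ᴴ * V.1) * A := by
    simp [Matrix.conjTranspose_mul, mul_assoc]
  rw [this, conjTranspose_mul_self, mul_one]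

theorem schattenNorm_specMat {n p : ℕ} (hp : Even p) (E : U n) (θ : Fin n → ℝ) :
    schattenNorm p (specMat E fun j => θ j * Complex.I) = (∑ j, θ j ^ p) ^ (1 / (p : ℝ)) := by
  unfold schattenNorm
  congr 1
  rw [specMat_conjTranspose, specMat_mul, specMat_pow, trace_specMat, Complex.re_sum]
  refine Finset.sum_congr rfl fun j _ => ?_
  obtain ⟨q, rfl⟩ := hp
  have e : (star (fun j => (θ j : ℂ) * Complex.I) * fun j => (θ j : ℂ) * Complex.I) j =
      ((θ j ^ 2 : ℝ) : ℂ) := by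
    have hI : Complex.I * Complex.I = -1 := Complex.I_mul_I
    simp only [Pi.mul_apply, Pi.star_apply, star_mul', RCLike.star_def, Complex.conj_ofReal,
      Complex.conj_I]
    push_cast
    linear_combination (-(θ j : ℂ) ^ 2) * hI
  rw [Pi.pow_apply, e, ← Complex.ofReal_pow, Complex.ofReal_re, ← pow_mul]
  congr 1; omega

theorem continuous_schattenNorm {n p : ℕ} :
    Continuous (schattenNorm p : Matrix (Fin n) (Fin n) ℂ → ℝ) := by
  unfold schattenNorm
  refine Continuous.rpow_const ?_ fun _ => Or.inr (by positivity)
  exact Complex.continuous_re.comp ((continuous_id.matrix_conjTranspose.matrix_mul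
    continuous_id).pow _).matrix_trace

/-! ### Lower bound for the length of curves -/

/-- The second order term of the majorant of the energy does not contribute to its derivative. -/
theorem hasDerivWithinAt_majorant {n p : ℕ} (C : ℝ) {Γ : ℝ → Matrix (Fin n) (Fin n) ℂ}
    {D : Matrix (Fin n) (Fin n) ℂ} {s : Set ℝ} {x : ℝ} (P : Matrix (Fin n) (Fin n) ℂ)
    (hD : ∀ i j, HasDerivWithinAt (fun t => Γ t i j) (D i j) s x) :
    HasDerivWithinAt (fun t => p * ((Γ t - Γ x) * P).trace.im + C * frobSq (Γ t - Γ x))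
      (p * (D * P).trace.im) s x := by
  have hsub : ∀ i j, HasDerivWithinAt (fun t => (Γ t - Γ x) i j) (D i j) s x := fun i j => by
    simpa only [Matrix.sub_apply] using (hD i j).sub_const (Γ x i j)
  have h1 : HasDerivWithinAt (fun t => ((Γ t - Γ x) * P).trace) (D * P).trace s x := by
    simp only [Matrix.trace, Matrix.diag_apply, Matrix.mul_apply]
    exact HasDerivWithinAt.fun_sum fun i _ => HasDerivWithinAt.fun_sum fun j _ =>
      (hsub i j).mul_const _
  have h2 : HasDerivWithinAt (fun t => ((Γ t - Γ x) * P).trace.im) (D * P).trace.im s x :=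
    Complex.imCLM.hasFDerivAt.comp_hasDerivWithinAt x h1
  have h3 : HasDerivWithinAt (fun t => frobSq (Γ t - Γ x)) 0 s x := by
    have h4 : HasDerivWithinAt (fun t => ∑ i, ∑ j, ‖(Γ t - Γ x) i j‖ ^ 2)
        (∑ i : Fin n, ∑ j : Fin n, (0 : ℝ)) s x := by
      refine HasDerivWithinAt.fun_sum fun i _ => HasDerivWithinAt.fun_sum fun j _ => ?_
      have := (hsub i j).norm_sq
      simpa using this
    simpa [frobSq, Complex.normSq_eq_norm_sq] using h4
  simpa only [mul_zero, add_zero] using (h2.const_mul (p : ℝ)).fun_add (h3.const_mul C)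

/-- Along a curve of unitary matrices the distance from the identity grows at most as fast as
the length. The curve may pass through the cut locus. -/
theorem angleNorm_le_add_integral {n p : ℕ} (hp : Even p) (hp2 : 2 ≤ p) {Γ : ℝ → U n}
    {D : ℝ → Matrix (Fin n) (Fin n) ℂ} {S : ℝ → ℝ} {a b : ℝ} (hab : a ≤ b) (hS : Continuous S)
    (hΓ : ContinuousOn Γ (Icc a b))
    (hD : ∀ t ∈ Ico a b, ∀ i j, HasDerivWithinAt (fun s => (Γ s).1 i j) (D t i j) (Ici t) t)
    (hSD : ∀ t ∈ Ico a b, schattenNorm p (D t) ≤ S t) :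
    angleNorm p (Γ b) ≤ angleNorm p (Γ a) + ∫ t in a..b, S t := by
  have hp0 : p ≠ 0 := by omega
  -- the slack `ε` keeps the comparison function positive and its slope strictly too large
  have key : ∀ ε > 0, angleNorm p (Γ b) ≤
      angleNorm p (Γ a) + ε + (∫ t in a..b, S t) + ε * (b - a) := by
    intro ε hε
    set g : ℝ → ℝ := fun x => angleNorm p (Γ a) + ε + (∫ t in a..x, S t) + ε * (x - a) with hg
    have hint : ∀ x ∈ Icc a b, 0 ≤ ∫ t in a..x, S t := by
      intro x hx
      rw [intervalIntegral.integral_of_le hx.1, MeasureTheory.integral_Ioc_eq_integral_Ioo]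
      refine MeasureTheory.setIntegral_nonneg measurableSet_Ioo fun t ht => ?_
      exact (schattenNorm_nonneg hp _).trans (hSD t ⟨ht.1.le, ht.2.trans_le hx.2⟩)
    have hgpos : ∀ x ∈ Icc a b, 0 < g x := by
      intro x hx
      have := hint x hx
      have := angleNorm_nonneg hp (Γ a)
      have : 0 ≤ ε * (x - a) := mul_nonneg hε.le (sub_nonneg.2 hx.1)
      simp only [hg]; linarith
    have hgd : ∀ x, HasDerivAt g (S x + ε) x := by
      intro x
      have h1 : HasDerivAt (fun x => ∫ t in a..x, S t) (S x) x :=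
        (hS.integral_hasStrictDerivAt a x).hasDerivAt
      have h2 : HasDerivAt (fun x => ε * (x - a)) ε x := by
        simpa using ((hasDerivAt_id x).sub_const a).const_mul ε
      exact (h1.const_add (angleNorm p (Γ a) + ε)).add h2
    obtain ⟨C, -, hC⟩ := exists_energy_le hp
    have main := image_le_of_liminf_slope_right_lt_deriv_boundary
      (f := fun t => energy p (Γ t)) (f' := fun t => p * (angleNorm p (Γ t) ^ (p - 1) * S t))
      (B := fun t => g t ^ p) (B' := fun t => p * g t ^ (p - 1) * (S t + ε))
      (a := a) (b := b) ((continuous_energy hp).comp_continuousOn hΓ) ?_ ?_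
      (fun x => (hgd x).pow p) ?_ (right_mem_Icc.2 hab)
    · simp only [← angleNorm_pow hp hp2] at main
      exact (pow_le_pow_iff_left₀ (angleNorm_nonneg hp _) (hgpos b (right_mem_Icc.2 hab)).le
        hp0).1 main
    · intro x hx r hr
      have hψ := hasDerivWithinAt_majorant (p := p) C (Γ := fun t => (Γ t).1)
        (energyGrad p (Γ x)) (hD x hx)
      rw [hasDerivWithinAt_iff_tendsto_slope, Ici_sdiff_left] at hψ
      have hlt : p * (D x * energyGrad p (Γ x)).trace.im < r := by
        refine lt_of_le_of_lt (mul_le_mul_of_nonneg_left ?_ (Nat.cast_nonneg p)) hr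
        refine (le_abs_self _).trans ((abs_im_trace_mul_energyGrad_le hp hp2 _ _).trans ?_)
        exact mul_le_mul_of_nonneg_left (hSD x hx) (pow_nonneg (angleNorm_nonneg hp _) _)
      refine ((hψ.eventually_lt_const hlt).and self_mem_nhdsWithin).frequently.mono ?_
      rintro z ⟨hz, hxz⟩
      refine lt_of_le_of_lt ?_ hz
      have hxz' : 0 < z - x := sub_pos.2 hxz
      rw [slope_def_field, slope_def_field]
      refine div_le_div_of_nonneg_right ?_ hxz'.le
      have := hC n (Γ z) (Γ x)
      simp only [sub_self, zero_mul, Matrix.trace_zero, Complex.zero_im, mul_zero, frobSq_zero,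
        add_zero, sub_zero]
      linarith
    · simp only [hg, intervalIntegral.integral_same, sub_self, mul_zero, add_zero]
      rw [← angleNorm_pow hp hp2]
      exact pow_le_pow_left₀ (angleNorm_nonneg hp _) (by linarith) _
    · intro x hx he
      have hx' := Ico_subset_Icc_self hx
      simp only [← angleNorm_pow hp hp2] at he
      have e : angleNorm p (Γ x) = g x :=
        (pow_left_inj₀ (angleNorm_nonneg hp _) (hgpos x hx').le hp0).1 he
      simp only [e]
      have h1 : 0 < (p : ℝ) * g x ^ (p - 1) := by
        have := pow_pos (hgpos x hx') (p - 1)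
        positivity
      rw [← mul_assoc]
      exact mul_lt_mul_of_pos_left (by linarith) h1
  refine le_of_forall_pos_le_add fun δ hδ => ?_
  have h1 : 0 < 1 + (b - a) := by linarith
  have := key (δ / (1 + (b - a))) (by positivity)
  have e : δ / (1 + (b - a)) + δ / (1 + (b - a)) * (b - a) = δ := by field_simp
  linarith

theorem continuousOn_of_contDiffOn {n : ℕ} {γ : ℝ → U n} {s : Set ℝ}
    (h : ∀ i j, ContDiffOn ℝ ∞ (fun t => (γ t).1 i j) s) : ContinuousOn γ s := by
  rw [Topology.IsInducing.subtypeVal.continuousOn_iff]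
  exact continuousOn_pi.2 fun i => continuousOn_pi.2 fun j => (h i j).continuousOn

theorem angleNorm_le_add_integral_velocity {n p : ℕ} (hp : Even p) (hp2 : 2 ≤ p) (V : U n)
    {γ : ℝ → U n} {a b : ℝ} (hab : a ≤ b)
    (h : ∀ i j, ContDiffOn ℝ ∞ (fun t => (γ t).1 i j) (Icc a b)) :
    IntervalIntegrable (fun t => schattenNorm p (velocity γ t)) MeasureTheory.volume a b ∧
    angleNorm p (V * γ b) ≤
      angleNorm p (V * γ a) + ∫ t in a..b, schattenNorm p (velocity γ t) := by
  rcases hab.eq_or_lt with rfl | hlt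
  · simp
  set D : ℝ → Matrix (Fin n) (Fin n) ℂ :=
    fun t => Matrix.of fun i j => derivWithin (fun s => (γ s).1 i j) (Icc a b) t with hDdef
  have hDc : ContinuousOn D (Icc a b) :=
    continuousOn_pi.2 fun i => continuousOn_pi.2 fun j =>
      (h i j).continuousOn_derivWithin (uniqueDiffOn_Icc hlt) (by norm_num)
  have hsc : ContinuousOn (fun t => schattenNorm p (D t)) (Icc a b) :=
    continuous_schattenNorm.comp_continuousOn hDc
  set S : ℝ → ℝ := IccExtend hab ((Icc a b).domRestrict fun t => schattenNorm p (D t)) with hSdef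
  have hS : Continuous S := hsc.domRestrict.Icc_extend'
  have hSD : ∀ t ∈ Icc a b, S t = schattenNorm p (D t) := fun t ht => by
    rw [hSdef, IccExtend_of_mem _ _ ht]; rfl
  have hDv : ∀ t ∈ Ioo a b, D t = velocity γ t := by
    intro t ht
    ext i j
    exact derivWithin_of_mem_nhds (Icc_mem_nhds ht.1 ht.2)
  have hSv : EqOn S (fun t => schattenNorm p (velocity γ t)) (Ioo a b) := fun t ht => by
    rw [hSD t (Ioo_subset_Icc_self ht), hDv t ht]
  refine ⟨(hS.intervalIntegrable a b).congr_uIoo (by rwa [uIoo_of_le hab]), ?_⟩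
  rw [← intervalIntegral.integral_congr_Ioo_of_le hab hSv]
  refine angleNorm_le_add_integral hp hp2 (Γ := fun t => V * γ t) (D := fun t => V.1 * D t)
    hab hS ?_ ?_ ?_
  · exact continuousOn_const.mul (continuousOn_of_contDiffOn h)
  · intro t ht i j
    have hd : ∀ k, HasDerivWithinAt (fun s => (γ s).1 k j) (D t k j) (Ici t) t := fun k => by
      have := ((h k j).differentiableOn (by norm_num) t (Ico_subset_Icc_self ht)).hasDerivWithinAt
      exact this.mono_of_mem_nhdsWithin (Icc_mem_nhdsGE_of_mem ht)
    simp only [Matrix.UnitaryGroup.mul_val, Matrix.mul_apply]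
    exact HasDerivWithinAt.fun_sum fun k _ => (hd k).const_mul _
  · intro t ht
    rw [schattenNorm_mul_left, hSD t (Ico_subset_Icc_self ht)]

theorem energy_one {n p : ℕ} (hp : Even p) (hp2 : 2 ≤ p) : energy p (1 : U n) = 0 := by
  have : (1 : U n).1 = expMat 1 (fun _ : Fin n => (0 : ℝ)) := by
    have e : (fun _ : Fin n => Complex.exp (((0 : ℝ) : ℂ) * Complex.I)) = 1 := by ext; simp
    rw [expMat, e, specMat_one]; rfl
  rw [energy_eq hp this (fun j => by simp [Real.pi_pos.le])]
  simp [zero_pow (show p ≠ 0 by omega)]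

/-- Every piecewise smooth curve is at least as long as the `p`-norm of the principal angles
between its endpoints. -/
theorem angleNorm_le_curveLength {n p : ℕ} (hp : Even p) (hp2 : 2 ≤ p) {γ : ℝ → U n}
    (hγ : IsPiecewiseSmooth γ) :
    angleNorm p ((γ 0)⁻¹ * γ 1) ≤ curveLength (schattenNorm p) γ := by
  obtain ⟨N, τ, hτ, h0, h1, h⟩ := hγ
  set V := (γ 0)⁻¹ with hV
  have hk : ∀ k < N, _ := fun k hk =>
    angleNorm_le_add_integral_velocity hp hp2 V (hτ (Nat.le_succ k)) (h k hk)
  have key : ∀ k ≤ N, angleNorm p (V * γ (τ k)) ≤ ∑ l ∈ Finset.range k,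
      ∫ t in τ l..τ (l + 1), schattenNorm p (velocity γ t) := by
    intro k
    induction k with
    | zero =>
      intro _
      rw [h0, hV, inv_mul_cancel, angleNorm, energy_one hp hp2, Finset.sum_range_zero,
        Real.zero_rpow]
      have : (p : ℝ) ≠ 0 := by positivity
      positivity
    | succ k ih =>
      intro hkN
      rw [Finset.sum_range_succ]
      exact (hk k hkN).2.trans (by gcongr; exact ih (by omega))
  have := key N le_rfl
  rwa [intervalIntegral.sum_integral_adjacent_intervals fun k hkN => (hk k hkN).1, h0, h1]
    at this

/-! ### Geodesics and the values of the distances -/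

theorem expMat_mem_unitaryGroup {n : ℕ} (E : U n) (θ : Fin n → ℝ) :
    expMat E θ ∈ Matrix.unitaryGroup (Fin n) ℂ := by
  rw [Matrix.mem_unitaryGroup_iff, Matrix.star_eq_conjTranspose, expMat, specMat_conjTranspose,
    specMat_mul, ← specMat_one E]
  congr 1
  ext j
  simp [Complex.mul_conj, Complex.normSq_eq_norm_sq, Complex.norm_exp_ofReal_mul_I]

/-- `expMat E θ` as an element of the unitary group. -/
noncomputable def expU {n : ℕ} (E : U n) (θ : Fin n → ℝ) : U n :=
  ⟨expMat E θ, expMat_mem_unitaryGroup E θ⟩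

theorem expU_frame_angles {n : ℕ} (W : U n) : expU (frame W) (angles W) = W :=
  Subtype.ext (eq_expMat W).symm

theorem expU_add {n : ℕ} (E : U n) (η θ : Fin n → ℝ) :
    expU E (η + θ) = expU E η * expU E θ := by
  apply Subtype.ext
  simp only [expU, Matrix.UnitaryGroup.mul_val, expMat, specMat_mul]
  congr 1
  ext j
  simp [add_mul, Complex.exp_add]

theorem expU_zero {n : ℕ} (E : U n) : expU E 0 = 1 := by
  have := expU_add E 0 0
  rwa [add_zero, left_eq_mul] at this

theorem expU_neg {n : ℕ} (E : U n) (θ : Fin n → ℝ) : expU E (-θ) = (expU E θ)⁻¹ := by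
  rw [eq_inv_iff_mul_eq_one, ← expU_add, neg_add_cancel, expU_zero]

/-- The curve `t ↦ u E diag(e^{itθ}) E^*`. -/
noncomputable def geodesic {n : ℕ} (u E : U n) (θ : Fin n → ℝ) (t : ℝ) : U n :=
  u * expU E (t • θ)

theorem geodesic_apply {n : ℕ} (u E : U n) (θ : Fin n → ℝ) (t : ℝ) (i j : Fin n) :
    (geodesic u E θ t).1 i j =
      ∑ k, (u.1 * E.1) i k * Complex.exp (t * (θ k * Complex.I)) * E.1ᴴ k j := by
  have : (geodesic u E θ t).1 = (u.1 * E.1) * Matrix.diagonal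
      (fun k => Complex.exp (t * (θ k * Complex.I))) * E.1ᴴ := by
    simp only [geodesic, expU, expMat, specMat, Matrix.UnitaryGroup.mul_val, mul_assoc]
    simp [mul_assoc]
  rw [this, Matrix.mul_apply]
  simp only [Matrix.mul_diagonal]

theorem isPiecewiseSmooth_geodesic {n : ℕ} (u E : U n) (θ : Fin n → ℝ) :
    IsPiecewiseSmooth (geodesic u E θ) := by
  refine ⟨1, fun k => ((min k 1 : ℕ) : ℝ), fun a b hab => ?_, by simp, by simp, fun k _ i j => ?_⟩
  · exact Nat.cast_le.2 (min_le_min_right 1 hab)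
  · refine ContDiff.contDiffOn ?_
    simp only [geodesic_apply]
    refine ContDiff.sum fun k _ => ?_
    have : ContDiff ℝ ∞ fun t : ℝ => (t : ℂ) := Complex.ofRealCLM.contDiff
    fun_prop

theorem velocity_geodesic {n : ℕ} (u E : U n) (θ : Fin n → ℝ) (t : ℝ) :
    velocity (geodesic u E θ) t =
      (geodesic u E θ t).1 * specMat E fun k => θ k * Complex.I := by
  have e : (geodesic u E θ t).1 * (specMat E fun k => θ k * Complex.I) =
      (u.1 * E.1) * Matrix.diagonal
        (fun k => Complex.exp (t * (θ k * Complex.I)) * (θ k * Complex.I)) * E.1ᴴ := by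
    have h := specMat_mul E (fun k => Complex.exp (((t • θ) k : ℝ) * Complex.I))
      (fun k => θ k * Complex.I)
    have e1 : (geodesic u E θ t).1 =
      u.1 * specMat E (fun k => Complex.exp (((t • θ) k : ℝ) * Complex.I)) := rfl
    rw [e1, mul_assoc, h, specMat]
    simp only [mul_assoc]
    congr 4
    ext k
    simp [mul_assoc]
  rw [e]
  ext i j
  rw [Matrix.mul_apply]
  simp only [velocity, Matrix.of_apply, Matrix.mul_diagonal, geodesic_apply]
  refine HasDerivAt.deriv (HasDerivAt.fun_sum fun k _ => HasDerivAt.mul_const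
    (HasDerivAt.const_mul _ ?_) _)
  have h1 : HasDerivAt (fun s : ℝ => (s : ℂ) * (θ k * Complex.I)) (θ k * Complex.I) t := by
    simpa using (hasDerivAt_id t).ofReal_comp.mul_const ((θ k : ℂ) * Complex.I)
  exact h1.cexp

theorem curveLength_geodesic {n p : ℕ} (hp : Even p) (u E : U n) (θ : Fin n → ℝ) :
    curveLength (schattenNorm p) (geodesic u E θ) = (∑ j, θ j ^ p) ^ (1 / (p : ℝ)) := by
  simp [curveLength, velocity_geodesic, schattenNorm_mul_left, schattenNorm_specMat hp]

section
open scoped Matrix.Norms.L2Operator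

theorem opNorm_mul_left {n : ℕ} (V : U n) (A : Matrix (Fin n) (Fin n) ℂ) :
    opNorm (V.1 * A) = opNorm A := by
  simp only [opNorm, Matrix.l2_opNorm_toEuclideanCLM]
  exact CStarRing.norm_coe_unitary_mul V A

theorem opNorm_specMat_lt {n : ℕ} (E : U n) {θ : Fin n → ℝ} {r : ℝ} (hr : 0 < r)
    (hθ : ∀ j, |θ j| < r) : opNorm (specMat E fun j => θ j * Complex.I) < r := by
  simp only [opNorm, Matrix.l2_opNorm_toEuclideanCLM, specMat]
  have h1 := CStarRing.norm_mul_coe_unitary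
    (E.1 * Matrix.diagonal fun j => (θ j : ℂ) * Complex.I) (E⁻¹ : U n)
  have h2 := CStarRing.norm_coe_unitary_mul E (Matrix.diagonal fun j => (θ j : ℂ) * Complex.I)
  refine lt_of_eq_of_lt (h1.trans h2) ?_
  rw [Matrix.l2_opNorm_diagonal, pi_norm_lt_iff hr]
  intro j
  simpa using hθ j

end

theorem curveLength_nonneg {n : ℕ} {N : Matrix (Fin n) (Fin n) ℂ → ℝ} (hN : ∀ x, 0 ≤ N x)
    (γ : ℝ → U n) : 0 ≤ curveLength N γ :=
  intervalIntegral.integral_nonneg zero_le_one fun _ _ => hN _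

theorem interiorDist_le_curveLength {n : ℕ} {N : Matrix (Fin n) (Fin n) ℂ → ℝ}
    (hN : ∀ x, 0 ≤ N x) {M : Set (U n)} {u v : U n} {γ : ℝ → U n} (hγ : Joins M u v γ) :
    interiorDist N M u v ≤ curveLength N γ := by
  refine csInf_le ⟨0, ?_⟩ ⟨γ, hγ, rfl⟩
  rintro _ ⟨γ, -, rfl⟩
  exact curveLength_nonneg hN γ

theorem joins_geodesic {n : ℕ} {M : Set (U n)} {u E : U n} {θ : Fin n → ℝ}
    (h : ∀ t ∈ Icc (0 : ℝ) 1, geodesic u E θ t ∈ M) :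
    Joins M u (u * expU E θ) (geodesic u E θ) :=
  ⟨isPiecewiseSmooth_geodesic u E θ, h, by simp [geodesic, expU_zero], by simp [geodesic]⟩

theorem distInf_lt_pi {n : ℕ} (u E : U n) {θ : Fin n → ℝ} (hθ : ∀ j, |θ j| < Real.pi) :
    distInf u (u * expU E θ) < Real.pi := by
  refine (interiorDist_le_curveLength (N := opNorm) (fun x => norm_nonneg _)
    (joins_geodesic fun t _ => mem_univ _)).trans_lt ?_
  simp only [curveLength, velocity_geodesic, opNorm_mul_left]
  simpa using opNorm_specMat_lt E Real.pi_pos hθ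

theorem isPrincipalLog_specMat {n : ℕ} (E : U n) {θ : Fin n → ℝ} (hθ : ∀ j, |θ j| < Real.pi) :
    IsPrincipalLog (specMat E fun j => θ j * Complex.I) (expU E θ).1 := by
  refine ⟨?_, opNorm_specMat_lt E Real.pi_pos hθ, exp_specMat E _⟩
  rw [specMat_conjTranspose, ← neg_one_smul ℂ, specMat_smul]
  congr 1
  ext j
  simp

theorem IsGeodesicSubset.geodesic_mem {n : ℕ} {M : Set (U n)} (hM : IsGeodesicSubset M)
    {u E : U n} {θ : Fin n → ℝ} (hu : u ∈ M) (hv : u * expU E θ ∈ M)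
    (hθ : ∀ j, |θ j| < Real.pi) {t : ℝ} (ht : t ∈ Icc (0 : ℝ) 1) : geodesic u E θ t ∈ M := by
  have hlog := isPrincipalLog_specMat E hθ
  rw [← inv_mul_cancel_left u (expU E θ)] at hlog
  obtain ⟨w, hw, he⟩ := hM.2 u hu _ hv (distInf_lt_pi u E hθ) _ hlog t ht
  convert hw
  apply Subtype.ext
  rw [he, ← algebraMap_smul ℂ t (specMat E _), specMat_smul, exp_specMat]
  simp only [geodesic, expU, expMat, Matrix.UnitaryGroup.mul_val]
  congr 3
  ext j
  simp [mul_assoc]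

theorem interiorDist_le_angleNorm {n p : ℕ} (hp : Even p) {M : Set (U n)} {u v : U n}
    (h : ∀ t ∈ Icc (0 : ℝ) 1, geodesic u (frame (u⁻¹ * v)) (angles (u⁻¹ * v)) t ∈ M) :
    interiorDist (schattenNorm p) M u v ≤ angleNorm p (u⁻¹ * v) := by
  have h1 := interiorDist_le_curveLength (schattenNorm_nonneg hp) (joins_geodesic h)
  rw [expU_frame_angles, mul_inv_cancel_left, curveLength_geodesic hp] at h1
  exact h1

theorem angleNorm_le_interiorDist {n p : ℕ} (hp : Even p) (hp2 : 2 ≤ p) {M : Set (U n)}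
    {u v : U n} (h : ∃ γ : ℝ → U n, Joins M u v γ) :
    angleNorm p (u⁻¹ * v) ≤ interiorDist (schattenNorm p) M u v := by
  obtain ⟨γ₀, h₀⟩ := h
  refine le_csInf ⟨_, γ₀, h₀, rfl⟩ ?_
  rintro _ ⟨γ, hγ, rfl⟩
  have := angleNorm_le_curveLength hp hp2 hγ.1
  rwa [hγ.2.2.1, hγ.2.2.2] at this

theorem exists_joins_univ {n : ℕ} (u v : U n) : ∃ γ : ℝ → U n, Joins univ u v γ := by
  have := joins_geodesic (M := univ) (u := u) (E := frame (u⁻¹ * v)) (θ := angles (u⁻¹ * v))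
    fun t _ => mem_univ _
  rw [expU_frame_angles, mul_inv_cancel_left] at this
  exact ⟨_, this⟩

theorem distP_eq_angleNorm {n p : ℕ} (hp : Even p) (hp2 : 2 ≤ p) (u v : U n) :
    distP p u v = angleNorm p (u⁻¹ * v) :=
  le_antisymm (interiorDist_le_angleNorm hp fun _ _ => mem_univ _)
    (angleNorm_le_interiorDist hp hp2 (exists_joins_univ u v))

/-- The interior distance of a geodesic set between points that are not opposite is the `p`-norm of
the vector of principal angles. -/
theorem IsGeodesicSubset.interiorDist_eq_angleNorm {n p : ℕ} (hp : Even p) (hp2 : 2 ≤ p)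
    {M : Set (U n)} (hM : IsGeodesicSubset M) {u v : U n} (hu : u ∈ M) (hv : v ∈ M)
    (h : ∀ j, |angles (u⁻¹ * v) j| < Real.pi) :
    interiorDist (schattenNorm p) M u v = angleNorm p (u⁻¹ * v) := by
  refine le_antisymm (interiorDist_le_angleNorm hp fun t ht => hM.geodesic_mem hu ?_ h ht)
    (angleNorm_le_interiorDist hp hp2 (hM.1 u hu v hv))
  rwa [expU_frame_angles, mul_inv_cancel_left]

/-! ### Strict convexity at midpoints -/

theorem sum_mul_overlap_pos {n : ℕ} (E G : U n) {k : Fin n → ℝ} (hk : ∀ i, 0 < k i) (j : Fin n) :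
    0 < ∑ i, k i * overlap E G i j := by
  have h0 : ∀ i, 0 ≤ k i * overlap E G i j := fun i =>
    mul_nonneg (hk i).le (overlap_nonneg _ _ _ _)
  refine (Finset.sum_nonneg fun i _ => h0 i).lt_of_ne fun h => ?_
  have h1 := (Finset.sum_eq_zero_iff_of_nonneg fun i _ => h0 i).1 h.symm
  have h2 : ∑ i, overlap E G i j = 0 := Finset.sum_eq_zero fun i hi =>
    (mul_eq_zero.1 (h1 i hi)).resolve_left (hk i).ne'
  rw [sum_overlap_left] at h2
  exact one_ne_zero h2

theorem conj_apply_self_re_pos {n : ℕ} {W : U n} (hW : ∀ j, |angles W j| < Real.pi / 2) (G : U n)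
    (j : Fin n) : 0 < ((G.1ᴴ * W.1 * G.1) j j).re := by
  rw [eq_expMat W, expMat, conj_specMat_apply, Complex.re_sum]
  simp only [Complex.re_mul_ofReal, Complex.exp_ofReal_mul_I_re]
  exact sum_mul_overlap_pos _ _ (fun i => Real.cos_pos_of_mem_Ioo (abs_lt.1 (hW i))) j

theorem abs_lt_pi_div_two_of_cos_pos {x : ℝ} (hx : |x| ≤ Real.pi) (h : 0 < Real.cos x) :
    |x| < Real.pi / 2 := by
  by_contra! hc
  rw [← Real.cos_abs] at h
  linarith [Real.cos_nonpos_of_pi_div_two_le_of_le hc (by linarith [Real.pi_pos])]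

theorem conjTranspose_frame_mul {n : ℕ} (S : U n) :
    (frame S).1ᴴ * S.1 =
      Matrix.diagonal (fun j => Complex.exp (angles S j * Complex.I)) * (frame S).1ᴴ := by
  conv_lhs => rw [eq_expMat S, expMat, specMat]
  rw [← mul_assoc, ← mul_assoc, conjTranspose_mul_self, one_mul]

theorem mul_frame {n : ℕ} (S : U n) :
    S.1 * (frame S).1 =
      (frame S).1 * Matrix.diagonal (fun j => Complex.exp (angles S j * Complex.I)) := by
  conv_lhs => rw [eq_expMat S, expMat, specMat]
  rw [mul_assoc, conjTranspose_mul_self, mul_one]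

/-- Two points at operator distance less than `π / 2` from a third one are not opposite. -/
theorem abs_angles_mul_inv_lt_pi {n : ℕ} {W W' : U n} (hW : ∀ j, |angles W j| < Real.pi / 2)
    (hW' : ∀ j, |angles W' j| < Real.pi / 2) (j : Fin n) : |angles (W * W'⁻¹) j| < Real.pi := by
  set S := W * W'⁻¹ with hS
  refine abs_lt.2 ⟨(angles_mem S j).1, (angles_mem S j).2.lt_of_ne fun h => ?_⟩
  have h1 : (frame S).1ᴴ * W.1 * (frame S).1 =
      Matrix.diagonal (fun j => Complex.exp (angles S j * Complex.I)) *
        ((frame S).1ᴴ * W'.1 * (frame S).1) := by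
    have : W.1 = S.1 * W'.1 := by
      rw [← Matrix.UnitaryGroup.mul_val, hS, inv_mul_cancel_right]
    rw [this, ← mul_assoc, conjTranspose_frame_mul]
    simp only [mul_assoc]
  have h2 := congr_fun (congr_fun h1 j) j
  rw [Matrix.diagonal_mul, h, Complex.exp_pi_mul_I, neg_one_mul] at h2
  have h3 := conj_apply_self_re_pos hW (frame S) j
  have h4 := conj_apply_self_re_pos hW' (frame S) j
  rw [h2, Complex.neg_re] at h3
  linarith

theorem expU_mul_add_expU_neg_mul {n : ℕ} (E : U n) (η : Fin n → ℝ) (Z : U n) :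
    (expU E η * Z).1 + (expU E (-η) * Z).1 =
      specMat E (fun j => ((2 * Real.cos (η j) : ℝ) : ℂ)) * Z.1 := by
  simp only [Matrix.UnitaryGroup.mul_val, expU, expMat]
  rw [← add_mul, specMat_add]
  congr 2
  ext j
  simp only [Pi.add_apply, Pi.neg_apply]
  push_cast
  rw [Complex.two_cos, neg_mul]

/-- Strict convexity of the energy at the midpoint `Z` of a geodesic with endpoints `W`, `W'` in
the open ball of radius `π / 2` for the operator norm. -/
theorem energy_midpoint_lt {n p : ℕ} (hp : Even p) (hp2 : 2 ≤ p) {E Z : U n} {η : Fin n → ℝ}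
    (hη : ∀ j, |η j| < Real.pi / 2)
    (hW : ∀ j, |angles (expU E η * Z) j| < Real.pi / 2)
    (hW' : ∀ j, |angles (expU E (-η) * Z) j| < Real.pi / 2)
    (hne : expU E η * Z ≠ expU E (-η) * Z) :
    (∀ j, |angles Z j| < Real.pi / 2) ∧
      2 * energy p Z < energy p (expU E η * Z) + energy p (expU E (-η) * Z) := by
  have hadd := expU_mul_add_expU_neg_mul E η Z
  set W := expU E η * Z with hWdef
  set W' := expU E (-η) * Z with hWdef'
  have hcos : ∀ j, 0 < 2 * Real.cos (η j) := fun j => by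
    have := Real.cos_pos_of_mem_Ioo (abs_lt.1 (hη j))
    positivity
  have hZ : ∀ j, |angles Z j| < Real.pi / 2 := by
    intro j
    refine abs_lt_pi_div_two_of_cos_pos (abs_angles_le Z j) ?_
    set G := frame Z with hG
    have h1 := conj_apply_self_re_pos hW G j
    have h2 := conj_apply_self_re_pos hW' G j
    have h3 : G.1ᴴ * W.1 * G.1 + G.1ᴴ * W'.1 * G.1 =
        (G.1ᴴ * specMat E (fun j => ((2 * Real.cos (η j) : ℝ) : ℂ)) * G.1) *
          Matrix.diagonal (fun j => Complex.exp (angles Z j * Complex.I)) := by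
      rw [← add_mul, ← mul_add, hadd, mul_assoc, mul_assoc, mul_assoc, mul_assoc, hG, mul_frame]
    have h4 := congr_arg Complex.re (congr_fun (congr_fun h3 j) j)
    rw [Matrix.add_apply, Complex.add_re, Matrix.mul_diagonal, conj_specMat_apply] at h4
    have h5 : ∑ i, ((2 * Real.cos (η i) : ℝ) : ℂ) * (overlap E G i j : ℂ) =
        ((∑ i, 2 * Real.cos (η i) * overlap E G i j : ℝ) : ℂ) := by push_cast; rfl
    rw [h5, Complex.re_ofReal_mul, Complex.exp_ofReal_mul_I_re] at h4
    exact (pos_iff_pos_of_mul_pos (h4 ▸ add_pos h1 h2)).1 (sum_mul_overlap_pos E G hcos j)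
  refine ⟨hZ, ?_⟩
  obtain ⟨h1, h1'⟩ := energy_add_le hp hp2 hW hZ
  obtain ⟨h2, h2'⟩ := energy_add_le hp hp2 hW' hZ
  -- the first order terms cancel, because `W + W'` is a positive multiple of `Z`
  have h3 : ((W.1 - Z.1) * energyGrad p Z).trace.im +
      ((W'.1 - Z.1) * energyGrad p Z).trace.im = 0 := by
    have e1 : (W.1 - Z.1) * energyGrad p Z + (W'.1 - Z.1) * energyGrad p Z =
        specMat E (fun j => ((2 * Real.cos (η j) : ℝ) : ℂ)) * (Z.1 * energyGrad p Z) -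
          (2 : ℂ) • (Z.1 * energyGrad p Z) := by
      rw [← add_mul, ← mul_assoc, ← hadd, ← smul_mul_assoc, ← sub_mul, two_smul]
      congr 1; abel
    have e2 : Z.1 * energyGrad p Z =
        specMat (frame Z) fun j => ((angles Z j ^ (p - 1) : ℝ) : ℂ) := by
      conv_lhs => rw [eq_expMat Z]
      exact expMat_mul_gradMat p _ _
    rw [← Complex.add_im, ← Matrix.trace_add, e1, e2, Matrix.trace_sub, Matrix.trace_smul,
      trace_specMat_mul_specMat, trace_specMat]
    simp only [← Complex.ofReal_mul, ← Complex.ofReal_sum]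
    simp only [Complex.sub_im, Complex.ofReal_im, smul_eq_mul, Complex.im_mul_ofReal,
      Complex.im_ofNat, zero_mul, sub_zero]
  have h4 : 2 * energy p Z ≤ energy p W + energy p W' := by nlinarith
  refine h4.lt_of_ne fun h5 => hne ?_
  have h6 : (p : ℝ) * ((W.1 - Z.1) * energyGrad p Z).trace.im +
      p * ((W'.1 - Z.1) * energyGrad p Z).trace.im = 0 := by rw [← mul_add, h3, mul_zero]
  rw [h1' (by linarith), h2' (by linarith)]

/-! ### Circumcenters of finite sets -/

theorem abs_angles_le_angleNorm {n p : ℕ} (hp : Even p) (hp2 : 2 ≤ p) (W : U n) (j : Fin n) :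
    |angles W j| ≤ angleNorm p W := by
  refine (pow_le_pow_iff_left₀ (abs_nonneg _) (angleNorm_nonneg hp W) (show p ≠ 0 by omega)).1 ?_
  rw [angleNorm_pow hp hp2, hp.pow_abs]
  exact Finset.single_le_sum (f := fun j => angles W j ^ p) (fun j _ => hp.pow_nonneg _)
    (Finset.mem_univ j)

theorem continuous_angleNorm {n p : ℕ} (hp : Even p) :
    Continuous (angleNorm p : U n → ℝ) :=
  (continuous_energy hp).rpow_const fun _ => Or.inr (by positivity)

theorem isCompact_univ_unitaryGroup (n : ℕ) : IsCompact (univ : Set (U n)) := by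
  rw [Topology.IsInducing.subtypeVal.isCompact_iff, image_univ, Subtype.range_coe]
  have hK : IsCompact
      {A : Matrix (Fin n) (Fin n) ℂ | ∀ i j, A i j ∈ Metric.closedBall (0 : ℂ) 1} := by
    have : {A : Matrix (Fin n) (Fin n) ℂ | ∀ i j, A i j ∈ Metric.closedBall (0 : ℂ) 1} =
        Set.pi univ fun _ : Fin n => Set.pi univ fun _ : Fin n => Metric.closedBall (0 : ℂ) 1 := by
      ext A
      exact ⟨fun h i _ j _ => h i j, fun h i j => h i trivial j trivial⟩
    rw [this]
    exact isCompact_univ_pi fun _ => isCompact_univ_pi fun _ => isCompact_closedBall _ _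
  refine hK.of_isClosed_subset ?_ fun A hA i j => ?_
  · have : {A : Matrix (Fin n) (Fin n) ℂ | A ∈ Matrix.unitaryGroup (Fin n) ℂ} =
        {A | A * Aᴴ = 1} := by
      ext A; exact Matrix.mem_unitaryGroup_iff
    change IsClosed {A : Matrix (Fin n) (Fin n) ℂ | A ∈ Matrix.unitaryGroup (Fin n) ℂ}
    rw [this]
    exact isClosed_eq (continuous_id.matrix_mul continuous_id.matrix_conjTranspose)
      continuous_const
  · simpa using entry_norm_bound_of_unitary hA i j

/-- The midpoint of two points at distance less than `π / 2` from `a` is strictly closer to `a`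
than the farther one of them. -/
theorem angleNorm_midpoint_lt {n p : ℕ} (hp : Even p) (hp2 : 2 ≤ p) {c c' a : U n} {R : ℝ}
    (hR : R < Real.pi / 2) (hc : angleNorm p (c⁻¹ * a) ≤ R) (hc' : angleNorm p (c'⁻¹ * a) ≤ R)
    (hne : c ≠ c') :
    (∀ j, |angles (c⁻¹ * c') j| < Real.pi) ∧
      angleNorm p ((geodesic c (frame (c⁻¹ * c')) (angles (c⁻¹ * c')) (1 / 2))⁻¹ * a) < R := by
  have hW : ∀ j, |angles (c⁻¹ * a) j| < Real.pi / 2 := fun j =>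
    ((abs_angles_le_angleNorm hp hp2 _ j).trans hc).trans_lt hR
  have hW' : ∀ j, |angles (c'⁻¹ * a) j| < Real.pi / 2 := fun j =>
    ((abs_angles_le_angleNorm hp hp2 _ j).trans hc').trans_lt hR
  have hS : c⁻¹ * a * (c'⁻¹ * a)⁻¹ = c⁻¹ * c' := by group
  have hlt := abs_angles_mul_inv_lt_pi hW hW'
  rw [hS] at hlt
  refine ⟨hlt, ?_⟩
  have hSexp := expU_frame_angles (c⁻¹ * c')
  set E := frame (c⁻¹ * c')
  set θ := angles (c⁻¹ * c')
  set η : Fin n → ℝ := (1 / 2 : ℝ) • θ with hη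
  have hηη : η + η = θ := by
    rw [hη, ← add_smul]; norm_num
  set Z := (geodesic c E θ (1 / 2))⁻¹ * a with hZ
  have hZ' : Z = (expU E η)⁻¹ * (c⁻¹ * a) := by
    rw [hZ, geodesic, mul_inv_rev, mul_assoc]
  have e1 : expU E η * Z = c⁻¹ * a := by rw [hZ', mul_inv_cancel_left]
  have e2 : expU E (-η) * Z = c'⁻¹ * a := by
    rw [hZ', expU_neg, ← mul_assoc, ← mul_inv_rev, ← expU_add, hηη, hSexp]
    group
  have hmid := energy_midpoint_lt hp hp2 (E := E) (Z := Z) (η := η) ?_ (by rwa [e1])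
    (by rwa [e2]) ?_
  · rw [e1, e2] at hmid
    have h1 := pow_le_pow_left₀ (angleNorm_nonneg hp _) hc p
    have h2 := pow_le_pow_left₀ (angleNorm_nonneg hp _) hc' p
    rw [angleNorm_pow hp hp2] at h1 h2
    refine lt_of_pow_lt_pow_left₀ p ((angleNorm_nonneg hp _).trans hc) ?_
    rw [angleNorm_pow hp hp2]
    linarith [hmid.2]
  · intro j
    have := hlt j
    rw [hη, Pi.smul_apply, smul_eq_mul, abs_mul, abs_of_pos (by norm_num : (0 : ℝ) < 1 / 2)]
    linarith
  · rw [e1, e2]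
    intro h
    exact hne (inv_injective (mul_right_cancel h))

/-- Existence and uniqueness of circumcenters for every distance on a closed geodesic set that
dominates `angleNorm p (u⁻¹ * v)` and agrees with it away from opposite points. -/
theorem existsUnique_isCircumcenter {n p : ℕ} (hp : Even p) (hp2 : 2 ≤ p) {M : Set (U n)}
    (hMc : IsClosed M) (hM : IsGeodesicSubset M) {d : U n → U n → ℝ}
    (hlow : ∀ u ∈ M, ∀ v ∈ M, angleNorm p (u⁻¹ * v) ≤ d u v)
    (hupp : ∀ u ∈ M, ∀ v ∈ M, (∀ j, |angles (u⁻¹ * v) j| < Real.pi) →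
      d u v ≤ angleNorm p (u⁻¹ * v))
    {A : Set (U n)} (hAM : A ⊆ M) (hA : A.Finite) (hA0 : A.Nonempty)
    (hr : circumradius d M A < Real.pi / 2) : ∃! c, IsCircumcenter d M A c := by
  obtain ⟨a₀, ha₀⟩ := hA0
  obtain ⟨r, ⟨c, hcM, hc⟩, hr⟩ := exists_lt_of_csInf_lt (by
    obtain ⟨r, hr⟩ := (hA.image (d a₀)).bddAbove
    exact ⟨r, a₀, hAM ha₀, fun a ha => hr (mem_image_of_mem _ ha)⟩) hr
  have hne : hA.toFinset.Nonempty := ⟨a₀, hA.mem_toFinset.2 ha₀⟩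
  -- the radius of the smallest ball with center `c`, measured by `angleNorm`, that contains `A`
  set R : U n → ℝ := fun c => hA.toFinset.sup' hne fun a => angleNorm p (c⁻¹ * a) with hR
  have hRle : ∀ c x, R c ≤ x ↔ ∀ a ∈ A, angleNorm p (c⁻¹ * a) ≤ x := fun c x => by
    simp [hR, Finset.sup'_le_iff]
  have hRlt : ∀ c x, R c < x ↔ ∀ a ∈ A, angleNorm p (c⁻¹ * a) < x := fun c x => by
    simp [hR, Finset.sup'_lt_iff]
  have hRc : Continuous R := Continuous.finset_sup'_apply hne fun a _ =>
    (continuous_angleNorm hp).comp (continuous_inv.mul continuous_const)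
  have hRd : ∀ c ∈ M, ∀ x, (∀ a ∈ A, d c a ≤ x) → R c ≤ x := fun c hc x h =>
    (hRle c x).2 fun a ha => (hlow c hc a (hAM ha)).trans (h a ha)
  have hdR : ∀ c ∈ M, R c < Real.pi / 2 → ∀ a ∈ A, d c a ≤ R c := fun c hc h a ha => by
    refine (hupp c hc a (hAM ha) fun j => ?_).trans ((hRle c _).1 le_rfl a ha)
    have := (abs_angles_le_angleNorm hp hp2 _ j).trans_lt ((hRlt c _).1 h a ha)
    linarith [Real.pi_pos]
  obtain ⟨c₀, hc₀M, hmin⟩ := ((isCompact_univ_unitaryGroup n).of_isClosed_subset hMc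
    (subset_univ M)).exists_isMinOn ⟨a₀, hAM ha₀⟩ hRc.continuousOn
  have hmin' : ∀ c ∈ M, R c₀ ≤ R c := fun c hc => hmin hc
  have h₀ : R c₀ < Real.pi / 2 := ((hmin' c hcM).trans (hRd c hcM r hc)).trans_lt hr
  refine ⟨c₀, ⟨hc₀M, R c₀, hdR c₀ hc₀M h₀, fun c' hc' r' h =>
    (hmin' c' hc').trans (hRd c' hc' r' h)⟩, ?_⟩
  rintro c₁ ⟨hc₁M, r₁, h₁, h₁'⟩
  by_contra hne'
  have hR₁ : R c₁ ≤ R c₀ := (hRd c₁ hc₁M r₁ h₁).trans (h₁' c₀ hc₀M _ (hdR c₀ hc₀M h₀))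
  have hmid := fun a ha => angleNorm_midpoint_lt hp hp2 h₀ ((hRle c₁ _).1 hR₁ a ha)
    ((hRle c₀ _).1 le_rfl a ha) hne'
  have hmM : geodesic c₁ (frame (c₁⁻¹ * c₀)) (angles (c₁⁻¹ * c₀)) (1 / 2) ∈ M := by
    refine hM.geodesic_mem hc₁M ?_ (hmid a₀ ha₀).1 ⟨by norm_num, by norm_num⟩
    rwa [expU_frame_angles, mul_inv_cancel_left]
  exact absurd ((hRlt _ _).2 fun a ha => (hmid a ha).2) (not_lt.2 (hmin' _ hmM))

/-! ### Optimality of the bound in the circle group -/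

theorem norm_apply_zero {W : U 1} : ‖W.1 0 0‖ = 1 := by
  have h := congr_fun (congr_fun (mul_conjTranspose_self W) 0) 0
  rw [Matrix.mul_apply, Fin.sum_univ_one, Matrix.conjTranspose_apply, Matrix.one_apply_eq,
    RCLike.star_def, Complex.mul_conj] at h
  have h' : Complex.normSq (W.1 0 0) = 1 := by exact_mod_cast h
  rw [Complex.normSq_eq_norm_sq] at h'
  nlinarith [norm_nonneg (W.1 0 0)]

theorem angleNorm_eq_abs_arg {p : ℕ} (hp : Even p) (hp2 : 2 ≤ p) (W : U 1) :
    angleNorm p W = |Complex.arg (W.1 0 0)| := by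
  have h : W.1 0 0 = Complex.exp (angles W 0 * Complex.I) := by
    have := congr_arg Matrix.trace (eq_expMat W)
    rw [expMat, trace_specMat, Fin.sum_univ_one, Matrix.trace_fin_one] at this
    exact this
  rw [h, Complex.arg_exp_mul_I, (toIocMod_eq_self _).2]
  · rw [angleNorm, energy, Fin.sum_univ_one, ← hp.pow_abs, one_div,
      Real.pow_rpow_inv_natCast (abs_nonneg _) (by omega)]
  · have := angles_mem W 0
    rwa [show -Real.pi + 2 * Real.pi = Real.pi by ring]

theorem distP_one_le_iff {p : ℕ} (hp : Even p) (hp2 : 2 ≤ p) (c : U 1) :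
    distP p c 1 ≤ Real.pi / 2 ↔ 0 ≤ (c.1 0 0).re := by
  rw [distP_eq_angleNorm hp hp2, angleNorm_eq_abs_arg hp hp2, Complex.abs_arg_le_pi_div_two_iff]
  simp

theorem inv_mul_neg_one_apply_re (c : U 1) : ((c⁻¹ * -1).1 0 0).re = -(c.1 0 0).re := by
  rw [mul_neg, mul_one]
  rfl

theorem distP_neg_one_le_iff {p : ℕ} (hp : Even p) (hp2 : 2 ≤ p) (c : U 1) :
    distP p c (-1) ≤ Real.pi / 2 ↔ (c.1 0 0).re ≤ 0 := by
  rw [distP_eq_angleNorm hp hp2, angleNorm_eq_abs_arg hp hp2, Complex.abs_arg_le_pi_div_two_iff,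
    inv_mul_neg_one_apply_re, neg_nonneg]

theorem pi_div_two_le_of_distP_le {p : ℕ} (hp : Even p) (hp2 : 2 ≤ p) {c : U 1} {r : ℝ}
    (h : ∀ a ∈ ({1, -1} : Set (U 1)), distP p c a ≤ r) : Real.pi / 2 ≤ r := by
  by_contra! hr
  have h1 := (h 1 (by simp)).trans_lt hr
  have h2 := (h (-1) (by simp)).trans_lt hr
  have hne : ∀ W : U 1, W.1 0 0 ≠ 0 := fun W => by
    rw [← norm_pos_iff, norm_apply_zero]; exact one_pos
  rw [distP_eq_angleNorm hp hp2, angleNorm_eq_abs_arg hp hp2,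
    Complex.abs_arg_lt_pi_div_two_iff, or_iff_left (hne _)] at h1 h2
  rw [inv_mul_neg_one_apply_re] at h2
  simp only [mul_one, Matrix.UnitaryGroup.inv_val, Matrix.star_apply, RCLike.star_def,
    Complex.conj_re] at h1
  linarith

/-- The element of `U_1` with entry `i`. -/
def unitaryI : U 1 := ⟨Matrix.of fun _ _ => Complex.I, by
  rw [Matrix.mem_unitaryGroup_iff]
  ext i j
  rw [Subsingleton.elim i j]
  simp [Matrix.mul_apply]⟩

theorem isCircumcenter_one_neg_one_iff {p : ℕ} (hp : Even p) (hp2 : 2 ≤ p) (c : U 1) :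
    IsCircumcenter (distP p) univ {1, -1} c ↔ c.1 0 0 = Complex.I ∨ c.1 0 0 = -Complex.I := by
  have hle : ∀ c : U 1, (c.1 0 0).re = 0 →
      ∀ a ∈ ({1, -1} : Set (U 1)), distP p c a ≤ Real.pi / 2 := by
    rintro c hc a (rfl | rfl)
    · exact (distP_one_le_iff hp hp2 c).2 hc.ge
    · exact (distP_neg_one_le_iff hp hp2 c).2 hc.le
  constructor
  · rintro ⟨-, r, hr, hmin⟩
    have h := hmin unitaryI (mem_univ _) _ (hle unitaryI Complex.I_re)
    have h1 := (distP_one_le_iff hp hp2 c).1 ((hr 1 (by simp)).trans h)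
    have h2 := (distP_neg_one_le_iff hp hp2 c).1 ((hr (-1) (by simp)).trans h)
    have h3 := le_antisymm h2 h1
    have h4 : ‖c.1 0 0‖ ^ 2 = 1 := by rw [norm_apply_zero]; norm_num
    rw [← Complex.normSq_eq_norm_sq, Complex.normSq_apply, h3, mul_zero, zero_add,
      mul_self_eq_one_iff] at h4
    exact h4.imp (fun h => Complex.ext h3 h) fun h =>
      Complex.ext (by simpa using h3) (by simpa using h)
  · intro h
    have h0 : (c.1 0 0).re = 0 := by rcases h with h | h <;> simp [h]
    exact ⟨mem_univ _, _, hle c h0, fun c' _ r' h' => pi_div_two_le_of_distP_le hp hp2 h'⟩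

theorem circumradius_one_neg_one {p : ℕ} (hp : Even p) (hp2 : 2 ≤ p) :
    circumradius (distP p) (univ : Set (U 1)) {1, -1} = Real.pi / 2 := by
  refine IsLeast.csInf_eq ⟨⟨unitaryI, mem_univ _, ?_⟩, ?_⟩
  · rintro a (rfl | rfl)
    · exact (distP_one_le_iff hp hp2 _).2 Complex.I_re.ge
    · exact (distP_neg_one_le_iff hp hp2 _).2 Complex.I_re.le
  · rintro r ⟨c, -, h⟩
    exact pi_div_two_le_of_distP_le hp hp2 h

theorem isGeodesicSubset_univ (n : ℕ) : IsGeodesicSubset (univ : Set (U n)) := by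
  refine ⟨fun u _ v _ => exists_joins_univ u v, fun u _ v _ _ x hx t _ => ?_⟩
  have hmem : NormedSpace.exp (t • x) ∈ Matrix.unitaryGroup (Fin n) ℂ := by
    rw [Matrix.mem_unitaryGroup_iff, Matrix.star_eq_conjTranspose, ← Matrix.exp_conjTranspose,
      Matrix.conjTranspose_smul, hx.1, smul_neg, star_trivial,
      ← Matrix.exp_add_of_commute _ _ (Commute.refl (t • x)).neg_right, add_neg_cancel,
      NormedSpace.exp_zero]
  exact ⟨u * ⟨_, hmem⟩, mem_univ _, rfl⟩

end FinslerUnitary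

theorem theorem4p7 :
    (∀ (n p : ℕ), Even p → 2 ≤ p →
      ∀ M : Set (FinslerUnitary.U n), IsClosed M → FinslerUnitary.IsGeodesicSubset M →
      ∀ A : Set (FinslerUnitary.U n), A ⊆ M → A.Finite → A.Nonempty →
        -- with the distance `d_p` of the unitary group, restricted to `M`
        (FinslerUnitary.circumradius (FinslerUnitary.distP p) M A < Real.pi / 2 →
          ∃! c, FinslerUnitary.IsCircumcenter (FinslerUnitary.distP p) M A c) ∧
        -- with the interior `p`-distance of `M`
        (FinslerUnitary.circumradius
            (FinslerUnitary.interiorDist (FinslerUnitary.schattenNorm p) M) M A < Real.pi / 2 →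
          ∃! c, FinslerUnitary.IsCircumcenter
            (FinslerUnitary.interiorDist (FinslerUnitary.schattenNorm p) M) M A c)) ∧
    -- optimality of the bound, in the whole group `U_1`
    (∀ p : ℕ, Even p → 2 ≤ p →
      FinslerUnitary.IsGeodesicSubset (Set.univ : Set (FinslerUnitary.U 1)) ∧
      FinslerUnitary.circumradius (FinslerUnitary.distP p) (Set.univ : Set (FinslerUnitary.U 1))
        {1, -1} = Real.pi / 2 ∧
      (∀ c : FinslerUnitary.U 1,
        FinslerUnitary.IsCircumcenter (FinslerUnitary.distP p) Set.univ {1, -1} c ↔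
          (c : Matrix (Fin 1) (Fin 1) ℂ) 0 0 = Complex.I ∨
          (c : Matrix (Fin 1) (Fin 1) ℂ) 0 0 = -Complex.I) ∧
      ¬ ∃! c : FinslerUnitary.U 1,
        FinslerUnitary.IsCircumcenter (FinslerUnitary.distP p) Set.univ {1, -1} c) := by
  refine ⟨fun n p hp hp2 M hMc hM A hAM hA hA0 => ⟨fun hr => ?_, fun hr => ?_⟩, fun p hp hp2 =>
    ⟨FinslerUnitary.isGeodesicSubset_univ 1, FinslerUnitary.circumradius_one_neg_one hp hp2,
      FinslerUnitary.isCircumcenter_one_neg_one_iff hp hp2, ?_⟩⟩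
  · exact FinslerUnitary.existsUnique_isCircumcenter hp hp2 hMc hM
      (fun u _ v _ => (FinslerUnitary.distP_eq_angleNorm hp hp2 u v).ge)
      (fun u _ v _ _ => (FinslerUnitary.distP_eq_angleNorm hp hp2 u v).le) hAM hA hA0 hr
  · exact FinslerUnitary.existsUnique_isCircumcenter hp hp2 hMc hM
      (fun u hu v hv => FinslerUnitary.angleNorm_le_interiorDist hp hp2 (hM.1 u hu v hv))
      (fun u hu v hv h => (hM.interiorDist_eq_angleNorm hp hp2 hu hv h).le) hAM hA hA0 hr
  · intro h
    have h1 := (FinslerUnitary.isCircumcenter_one_neg_one_iff hp hp2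
      FinslerUnitary.unitaryI).2 (Or.inl rfl)
    have h2 := (FinslerUnitary.isCircumcenter_one_neg_one_iff hp hp2
      (-FinslerUnitary.unitaryI)).2 (Or.inr rfl)
    have h3 := congr_fun (congr_fun (congr_arg Subtype.val (h.unique h1 h2)) 0) 0
    exact Complex.I_ne_zero (self_eq_neg.1 h3)
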